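/- Let $\Lambda$ be a set with $|\Lambda| = d$ (of any cardinality), let $H$ be a Hilbert space with an orthonormal basis $(e_i)_{i\in\Lambda}$, by means of which $H = \ell^2(\Lambda)$, and let $\mathcal F(H) = \bigoplus_{n\ge 0} H^{\otimes n}$ be the full Fock space. For $x \in H^{\otimes n}$ let $L(x) \in B(\mathcal F(H))$ be the creation operator $L(x)v = x \otimes v$, and let $\mathfrak A_d \subseteq B(\mathcal F(H))$ be the noncommutative disc algebra, that is, the norm closed unital algebra generated by $\{L(x) : x \in H\}$. Let $X = (X_n)_{n \ge 0}$ be a subproduct system with $X_1 = H$: closed subspaces $X_n \subseteq H^{\otimes n}$ with $X_0 = \mathbb C$, $X_1 = H$ and $X_{m+n} \subseteq X_m \otimes X_n$ (Hilbert space tensor product) for all $m, n$. Let $\mathcal F_X = \bigoplus_{n \ge 0} X_n \subseteq \mathcal F(H)$. For $x \in X_1$ let $S(x) \in B(\mathcal F_X)$ be the shift given by $S(x) y = p_{n+1}(x \otimes y)$ for $y \in X_n$, where $p_k$ is the orthogonal projection of $H^{\otimes k}$ onto $X_k$, and let $\mathcal A_X \subseteq B(\mathcal F_X)$ be the tensor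 algebra of $X$, that is, the norm closed unital algebra generated by $\{S(x) : x \in X_1\}$. Let $$J_X = \overline{\operatorname{span}}^{\|\cdot\|} \bigcup_{n \ge 0} \{ L(x) : x \in H^{\otimes n} \ominus X_n \},$$ which is a closed two-sided ideal of $\mathfrak A_d$. Theorem. The compression map $f \mapsto P_{\mathcal F_X} f|_{\mathcal F_X}$ on $\mathfrak A_d$ has kernel $J_X$ and range $\mathcal A_X$, that is, $\mathcal A_X = P_{\mathcal F_X} \mathfrak A_d|_{\mathcal F_X}$, and it induces a completely isometric algebra isomorphism of $\mathfrak A_d / J_X$ onto $\mathcal A_X$. Here $M_n(\mathfrak A_d / J_X) = M_n(\mathfrak A_d)/M_n(J_X)$ carries the quotient norm, and $M_n(\mathfrak A_d) \subseteq B(\mathcal F(H)^n)$ and $M_n(\mathcal A_X) \subseteq B(\mathcal F_X^n)$ carry the operator norm. -/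

import Mathlib

open scoped ENNReal InnerProductSpace

noncomputable section

/-! ### The full Fock space

`H = ℓ²(Λ)` is the Hilbert space with orthonormal basis indexed by `Λ`.  Its `n`-th Hilbert space
tensor power has the orthonormal basis `e_{i₁} ⊗ ⋯ ⊗ e_{iₙ}` indexed by the words `i₁ ⋯ iₙ` of
length `n`, and the full Fock space `⨁ₙ H^{⊗n}` has an orthonormal basis indexed by all words. -/

/-- The full Fock space `𝓕(H) = ⨁ₙ H^{⊗n}` over `H = ℓ²(Λ)`. -/
def FockSpace (Λ : Type*) : Type _ := lp (fun _ : List Λ => ℂ) 2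

namespace FockSpace

variable {Λ : Type*}

instance : NormedAddCommGroup (FockSpace Λ) :=
  inferInstanceAs (NormedAddCommGroup (lp (fun _ : List Λ => ℂ) 2))

instance : InnerProductSpace ℂ (FockSpace Λ) :=
  inferInstanceAs (InnerProductSpace ℂ (lp (fun _ : List Λ => ℂ) 2))

instance : CompleteSpace (FockSpace Λ) :=
  inferInstanceAs (CompleteSpace (lp (fun _ : List Λ => ℂ) 2))

/-- An element of the full Fock space is a function on words, its family of coefficients. -/
instance : CoeFun (FockSpace Λ) fun _ => List Λ → ℂ where
  coe v := (show lp (fun _ : List Λ => ℂ) 2 from v).1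

@[ext] theorem ext {u v : FockSpace Λ} (h : ∀ w, u w = v w) : u = v := lp.ext (funext h)

@[simp] theorem zero_apply (w : List Λ) : (0 : FockSpace Λ) w = 0 := rfl

@[simp] theorem add_apply (u v : FockSpace Λ) (w : List Λ) : (u + v) w = u w + v w := rfl

@[simp] theorem smul_apply (c : ℂ) (u : FockSpace Λ) (w : List Λ) : (c • u) w = c * u w := rfl

theorem summable_sq (v : FockSpace Λ) : Summable fun w => ‖v w‖ ^ 2 := by
  simpa using (lp.memℓp (E := fun _ : List Λ => ℂ) (p := 2) v).summable (by norm_num)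

theorem summable_inner (u v : FockSpace Λ) : Summable fun w => ⟪u w, v w⟫_ℂ :=
  lp.summable_inner (G := fun _ : List Λ => ℂ) u v

theorem inner_eq_tsum (u v : FockSpace Λ) : ⟪u, v⟫_ℂ = ∑' w, ⟪u w, v w⟫_ℂ := rfl

end FockSpace

/-- The tensor power `H^{⊗n}`, as the subspace of the full Fock space of the square summable
families of coefficients carried by the words of length `n`. -/
def tensorPower (Λ : Type*) (n : ℕ) : Submodule ℂ (FockSpace Λ) where
  carrier := {u | ∀ w : List Λ, w.length ≠ n → u w = 0}
  zero_mem' := fun _ _ => rfl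
  add_mem' := fun {u v} hu hv w hw => by simp [hu w hw, hv w hw]
  smul_mem' := fun c u hu w hw => by simp [hu w hw]

theorem isClosed_tensorPower (Λ : Type*) (n : ℕ) :
    IsClosed (tensorPower Λ n : Set (FockSpace Λ)) := by
  have h : (tensorPower Λ n : Set (FockSpace Λ)) =
      ⋂ w ∈ {w : List Λ | w.length ≠ n}, {u : FockSpace Λ | u w = 0} := by
    ext u
    simp only [Set.mem_iInter, Set.mem_ofPred_eq]
    rfl
  rw [h]
  exact isClosed_biInter fun w _ => isClosed_eq
    (lp.evalCLM ℂ (fun _ : List Λ => ℂ) (p := 2) w).continuous continuous_const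

theorem inner_eq_zero_of_ne {Λ : Type*} {m n : ℕ} (h : m ≠ n) {u v : FockSpace Λ}
    (hu : u ∈ tensorPower Λ m) (hv : v ∈ tensorPower Λ n) : ⟪u, v⟫_ℂ = 0 := by
  rw [FockSpace.inner_eq_tsum]
  refine (tsum_congr fun w => ?_).trans tsum_zero
  by_cases hw : w.length = m
  · rw [hv w (by omega), inner_zero_right]
  · rw [hu w hw, inner_zero_left]

theorem splitWord_injective {Λ : Type*} (n : ℕ) :
    Function.Injective (fun w : List Λ => (w.take n, w.drop n)) := by
  intro a b h
  simp only [Prod.mk.injEq] at h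
  rw [← List.take_append_drop n a, ← List.take_append_drop n b, h.1, h.2]

/-- The coefficient of the word `w` in `u ⊗ v`, for `u ∈ H^{⊗n}`.  If `w` is shorter than `n`,
then `w.take n = w` is not of length `n` and the coefficient is `0`. -/
def tensorCoeff {Λ : Type*} {n : ℕ} (u : tensorPower Λ n) (v : FockSpace Λ) (w : List Λ) : ℂ :=
  (u : FockSpace Λ) (w.take n) * v (w.drop n)

theorem summable_prod_sq {Λ : Type*} (u v : FockSpace Λ) :
    Summable fun p : List Λ × List Λ => ‖u p.1‖ ^ 2 * ‖v p.2‖ ^ 2 :=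
  u.summable_sq.mul_of_nonneg v.summable_sq (fun _ => by positivity) (fun _ => by positivity)

theorem memℓp_tensorCoeff {Λ : Type*} {n : ℕ} (u : tensorPower Λ n) (v : FockSpace Λ) :
    Memℓp (tensorCoeff u v) 2 := by
  apply memℓp_gen
  have h := (summable_prod_sq (u : FockSpace Λ) v).comp_injective (splitWord_injective n)
  refine h.congr fun w => ?_
  simp [tensorCoeff, mul_pow]

/-- `u ⊗ v` for `u ∈ H^{⊗n}` and `v` in the full Fock space. -/
def tensor {Λ : Type*} {n : ℕ} (u : tensorPower Λ n) (v : FockSpace Λ) : FockSpace Λ :=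
  ⟨tensorCoeff u v, memℓp_tensorCoeff u v⟩

theorem tensor_apply {Λ : Type*} {n : ℕ} (u : tensorPower Λ n) (v : FockSpace Λ) (w : List Λ) :
    tensor u v w = (u : FockSpace Λ) (w.take n) * v (w.drop n) := rfl

theorem inner_tensor {Λ : Type*} {n : ℕ} (u x : tensorPower Λ n) (v y : FockSpace Λ) :
    ⟪tensor u v, tensor x y⟫_ℂ = ⟪u, x⟫_ℂ * ⟪v, y⟫_ℂ := by
  have hs := FockSpace.summable_inner (u : FockSpace Λ) x
  have hs' := FockSpace.summable_inner v y
  rw [Submodule.coe_inner, FockSpace.inner_eq_tsum, FockSpace.inner_eq_tsum, FockSpace.inner_eq_tsum,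
    tsum_mul_tsum_of_summable_norm hs.norm hs'.norm,
    ← (splitWord_injective n).tsum_eq]
  · refine tsum_congr fun w => ?_
    simp only [tensor_apply, RCLike.inner_apply, map_mul]
    ring
  · rintro ⟨a, b⟩ hab
    refine ⟨a ++ b, ?_⟩
    have ha : a.length = n := by
      by_contra hne
      exact hab (by simp [u.2 a hne])
    simp [← ha]

theorem norm_tensor {Λ : Type*} {n : ℕ} (u : tensorPower Λ n) (v : FockSpace Λ) :
    ‖tensor u v‖ = ‖u‖ * ‖v‖ := by
  have h := inner_tensor u u v v
  have hu := inner_self_eq_norm_sq_to_K (𝕜 := ℂ) u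
  rw [inner_self_eq_norm_sq_to_K, hu, inner_self_eq_norm_sq_to_K] at h
  have h' : ‖tensor u v‖ ^ 2 = (‖u‖ * ‖v‖) ^ 2 := by
    rw [mul_pow]; exact_mod_cast h
  exact (sq_eq_sq₀ (norm_nonneg _) (by positivity)).1 h'

/-- The left creation operator `L(u) : v ↦ u ⊗ v`, for `u ∈ H^{⊗n}`. -/
def creation {Λ : Type*} {n : ℕ} (u : tensorPower Λ n) : FockSpace Λ →L[ℂ] FockSpace Λ :=
  LinearMap.mkContinuous
    { toFun := tensor u
      map_add' := fun v v' => by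
        ext w; simp [tensor_apply, mul_add]
      map_smul' := fun c v => by
        ext w; simp [tensor_apply]; ring }
    ‖u‖ (fun v => (norm_tensor u v).le)

theorem creation_apply {Λ : Type*} {n : ℕ} (u : tensorPower Λ n) (v : FockSpace Λ) :
    creation u v = tensor u v := rfl

theorem tensor_mem {Λ : Type*} {m n : ℕ} (u : tensorPower Λ m) (v : tensorPower Λ n) :
    tensor u (v : FockSpace Λ) ∈ tensorPower Λ (m + n) := by
  intro w hw
  rw [tensor_apply]
  by_cases h : (w.take m).length = m
  · rw [v.2 (w.drop m) (by simp at h ⊢; omega), mul_zero]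
  · rw [u.2 _ h, zero_mul]

/-- `u ⊗ v ∈ H^{⊗(m+n)}` for `u ∈ H^{⊗m}` and `v ∈ H^{⊗n}`. -/
def tmul {Λ : Type*} {m n : ℕ} (u : tensorPower Λ m) (v : tensorPower Λ n) :
    tensorPower Λ (m + n) :=
  ⟨tensor u v, tensor_mem u v⟩

theorem inner_tmul {Λ : Type*} {m n : ℕ} (u x : tensorPower Λ m) (v y : tensorPower Λ n) :
    ⟪tmul u v, tmul x y⟫_ℂ = ⟪u, x⟫_ℂ * ⟪v, y⟫_ℂ :=
  inner_tensor u x v y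

theorem creation_tmul {Λ : Type*} {m n : ℕ} (u : tensorPower Λ m) (v : tensorPower Λ n) :
    creation (tmul u v) = creation u * creation v := by
  ext z w
  simp only [ContinuousLinearMap.mul_def, ContinuousLinearMap.comp_apply, creation_apply, tensor_apply, tmul]
  rw [List.take_take, List.drop_drop, List.drop_take, min_eq_left (by omega),
    show m + n - m = n by omega, mul_assoc]

/-! ### Operator algebras and matrix norms -/

/-- The norm closed unital algebra of operators on `E` generated by a set of operators. -/
def closedAlgebra {E : Type*} [NormedAddCommGroup E] [InnerProductSpace ℂ E]
    (s : Set (E →L[ℂ] E)) : Subalgebra ℂ (E →L[ℂ] E) :=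
  (Algebra.adjoin ℂ s).topologicalClosure

/-- The operator on `E ⊕ ⋯ ⊕ E` (Hilbert space direct sum of `n` copies) given by an `n × n`
matrix of operators on `E`. -/
def matrixOperator {E : Type*} [NormedAddCommGroup E] [InnerProductSpace ℂ E] {n : ℕ}
    (T : Matrix (Fin n) (Fin n) (E →L[ℂ] E)) :
    PiLp 2 (fun _ : Fin n => E) →L[ℂ] PiLp 2 (fun _ : Fin n => E) :=
  (PiLp.continuousLinearEquiv 2 ℂ (fun _ : Fin n => E)).symm.toContinuousLinearMap ∘L
    ContinuousLinearMap.pi fun i => ∑ j, T i j ∘L PiLp.proj 2 (fun _ : Fin n => E) j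

/-- The norm on `M_n(A)` for an algebra `A ⊆ B(E)` of operators, namely that of
`M_n(B(E)) = B(E ⊕ ⋯ ⊕ E)`. -/
def matrixNorm {E : Type*} [NormedAddCommGroup E] [InnerProductSpace ℂ E]
    {A : Subalgebra ℂ (E →L[ℂ] E)} {n : ℕ} (T : Matrix (Fin n) (Fin n) A) : ℝ :=
  ‖matrixOperator (T.map fun a => (a : E →L[ℂ] E))‖

/-- The quotient norm on `M_n(A ⧸ J) = M_n(A) ⧸ M_n(J)`: the infimum of the norms of all lifts to
`M_n(A)`. -/
def quotientMatrixNorm {E : Type*} [NormedAddCommGroup E] [InnerProductSpace ℂ E]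
    {A : Subalgebra ℂ (E →L[ℂ] E)} {J : Ideal A} [J.IsTwoSided] {n : ℕ}
    (F : Matrix (Fin n) (Fin n) (A ⧸ J)) : ℝ :=
  sInf (matrixNorm '' {T : Matrix (Fin n) (Fin n) A | T.map (Ideal.Quotient.mk J) = F})

/-- An algebra isomorphism from a quotient `A ⧸ J` of an operator algebra onto an operator algebra
`B` is completely isometric if all its entrywise amplifications `M_n(A ⧸ J) → M_n(B)` are
isometric. -/
def IsCompletelyIsometric {E K : Type*} [NormedAddCommGroup E] [InnerProductSpace ℂ E]
    [NormedAddCommGroup K] [InnerProductSpace ℂ K]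
    {A : Subalgebra ℂ (E →L[ℂ] E)} {J : Ideal A} [J.IsTwoSided]
    {B : Subalgebra ℂ (K →L[ℂ] K)} (φ : (A ⧸ J) ≃ₐ[ℂ] B) : Prop :=
  ∀ (n : ℕ) (F : Matrix (Fin n) (Fin n) (A ⧸ J)), matrixNorm (F.map φ) = quotientMatrixNorm F

/-- The noncommutative disc algebra `𝔄_d`, `d = |Λ|`: the norm closed unital algebra of operators
on the full Fock space generated by the creation operators `L(x)`, `x ∈ H`. -/
def discAlgebra (Λ : Type*) : Subalgebra ℂ (FockSpace Λ →L[ℂ] FockSpace Λ) :=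
  closedAlgebra (Set.range fun x : tensorPower Λ 1 => creation x)

/-! ### Subproduct systems -/

/-- A subproduct system `X = (X_n)` with `X_1 = H = ℓ²(Λ)`: closed subspaces `X_n ⊆ H^{⊗n}` with
`X_0 = ℂ`, `X_1 = H` and `X_{m+n} ⊆ X_m ⊗ X_n`, the latter being the closed span of the
`u ⊗ v` with `u ∈ X_m`, `v ∈ X_n`. -/
structure SubproductSystem (Λ : Type*) where
  fiber : (n : ℕ) → Submodule ℂ (tensorPower Λ n)
  isClosed_fiber : ∀ n, IsClosed (fiber n : Set (tensorPower Λ n))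
  fiber_zero : fiber 0 = ⊤
  fiber_one : fiber 1 = ⊤
  fiber_add_le : ∀ m n, fiber (m + n) ≤
    (Submodule.span ℂ (Set.image2 tmul (fiber m : Set (tensorPower Λ m))
      (fiber n : Set (tensorPower Λ n)))).topologicalClosure

namespace SubproductSystem

variable {Λ : Type*} (X : SubproductSystem Λ)

/-- The fiber `X_n` as a subspace of the full Fock space. -/
def fockFiber (n : ℕ) : Submodule ℂ (FockSpace Λ) :=
  (X.fiber n).map (tensorPower Λ n).subtype

/-- The `X`-Fock space `𝓕_X = ⨁ₙ X_n`, as a closed subspace of the full Fock space. -/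
def fock : Submodule ℂ (FockSpace Λ) :=
  (⨆ n, X.fockFiber n).topologicalClosure

instance : CompleteSpace X.fock :=
  inferInstanceAs (CompleteSpace (⨆ n, X.fockFiber n).topologicalClosure)

/-- The compression `T ↦ P_{𝓕_X} T |_{𝓕_X}` from `B(𝓕(H))` to `B(𝓕_X)`. -/
def compression (T : FockSpace Λ →L[ℂ] FockSpace Λ) : X.fock →L[ℂ] X.fock :=
  X.fock.orthogonalProjectionOnto ∘L T ∘L X.fock.subtypeL

/-- The shift `S(x)`, `x ∈ X_m`, on the `X`-Fock space.  It maps `y ∈ X_n` to `p_{m+n}(x ⊗ y)`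
(see `shift_apply_fiber`), where `p_k` is the orthogonal projection of `H^{⊗k}` onto `X_k`. -/
def shift {m : ℕ} (x : X.fiber m) : X.fock →L[ℂ] X.fock :=
  X.compression (creation (x : tensorPower Λ m))

/-- The tensor algebra `𝓐_X`: the norm closed unital algebra of operators on `𝓕_X` generated by the
shifts `S(x)`, `x ∈ X_1`. -/
def tensorAlgebra : Subalgebra ℂ (X.fock →L[ℂ] X.fock) :=
  closedAlgebra (Set.range fun x : X.fiber 1 => X.shift x)

instance (n : ℕ) : CompleteSpace (X.fiber n) := by
  have := (isClosed_tensorPower Λ n).completeSpace_coe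
  exact (X.isClosed_fiber n).completeSpace_coe

/-- The shift acts on the summands of `𝓕_X` as it should: `S(x) y = p_{m+n}(x ⊗ y)` for
`x ∈ X_m` and `y ∈ X_n`. -/
theorem shift_apply_fiber {m n : ℕ} (x : X.fiber m) (y : X.fiber n) (y' : X.fock)
    (hy : (y' : FockSpace Λ) = (y : tensorPower Λ n)) :
    ((X.shift x y' : X.fock) : FockSpace Λ) =
      ((X.fiber (m + n)).starProjection (tmul (x : tensorPower Λ m) (y : tensorPower Λ n)) :
        tensorPower Λ (m + n)) := by
  set t : tensorPower Λ (m + n) := tmul (x : tensorPower Λ m) (y : tensorPower Λ n) with ht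
  set z := (X.fiber (m + n)).starProjection t with hz
  have hz1 : z ∈ X.fiber (m + n) := Submodule.starProjection_apply_mem _ _
  have hz2 : t - z ∈ (X.fiber (m + n))ᗮ := Submodule.sub_starProjection_mem_orthogonal _
  have h1 : (X.shift x y' : FockSpace Λ) = X.fock.starProjection (t : FockSpace Λ) := by
    rw [Submodule.starProjection_apply]
    simp only [shift, compression, ContinuousLinearMap.comp_apply, Submodule.subtypeL_apply, hy]
    rfl
  rw [h1]
  refine (Submodule.eq_starProjection_of_mem_orthogonal ?_ ?_)
  · exact Submodule.le_topologicalClosure _ (Submodule.mem_iSup_of_mem (m + n) ⟨z, hz1, rfl⟩)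
  · rw [fock, Submodule.orthogonal_closure, ← Submodule.iInf_orthogonal, Submodule.mem_iInf]
    intro k
    rw [Submodule.mem_orthogonal]
    rintro _ ⟨v, hv, rfl⟩
    by_cases hk : k = m + n
    · subst hk
      exact (Submodule.mem_orthogonal _ _).1 hz2 v hv
    · exact inner_eq_zero_of_ne hk v.2 (t - z).2

theorem mem_orthogonal_fiber_add {m n : ℕ} {t : tensorPower Λ (m + n)}
    (h : ∀ u ∈ X.fiber m, ∀ v ∈ X.fiber n, ⟪tmul u v, t⟫_ℂ = 0) : t ∈ (X.fiber (m + n))ᗮ := by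
  refine Submodule.orthogonal_le (X.fiber_add_le m n) ?_
  rw [Submodule.orthogonal_closure, Submodule.mem_orthogonal]
  intro z hz
  induction hz using Submodule.span_induction with
  | mem z hz =>
    obtain ⟨u, hu, v, hv, rfl⟩ := hz
    exact h u hu v hv
  | zero => exact inner_zero_left _
  | add a b _ _ ha hb => rw [inner_add_left, ha, hb, add_zero]
  | smul c a _ ha => rw [inner_smul_left, ha, mul_zero]

theorem tmul_mem_orthogonal_left {m n : ℕ} (u : tensorPower Λ m) {x : tensorPower Λ n}
    (hx : x ∈ (X.fiber n)ᗮ) : tmul u x ∈ (X.fiber (m + n))ᗮ :=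
  X.mem_orthogonal_fiber_add fun a _ b hb => by
    rw [inner_tmul, (Submodule.mem_orthogonal _ _).1 hx b hb, mul_zero]

theorem tmul_mem_orthogonal_right {m n : ℕ} {x : tensorPower Λ m} (hx : x ∈ (X.fiber m)ᗮ)
    (u : tensorPower Λ n) : tmul x u ∈ (X.fiber (m + n))ᗮ :=
  X.mem_orthogonal_fiber_add fun a ha b _ => by
    rw [inner_tmul, (Submodule.mem_orthogonal _ _).1 hx a ha, zero_mul]

/-- The norm closed span of `⋃ₙ H^{⊗n} ⊖ X_n`, with `x ∈ H^{⊗n}` regarded as the operator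
`L(x)`. -/
def idealClosure : Submodule ℂ (FockSpace Λ →L[ℂ] FockSpace Λ) :=
  (Submodule.span ℂ {T | ∃ (n : ℕ) (x : tensorPower Λ n), x ∈ (X.fiber n)ᗮ ∧
    T = creation x}).topologicalClosure

theorem creation_mem_idealClosure {n : ℕ} {x : tensorPower Λ n} (hx : x ∈ (X.fiber n)ᗮ) :
    creation x ∈ X.idealClosure :=
  Submodule.le_topologicalClosure _ (Submodule.subset_span ⟨n, x, hx, rfl⟩)

theorem isClosed_idealClosure :
    IsClosed (X.idealClosure : Set (FockSpace Λ →L[ℂ] FockSpace Λ)) :=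
  Submodule.isClosed_topologicalClosure _

theorem creation_mul_mem {n : ℕ} (u : tensorPower Λ n) {f : FockSpace Λ →L[ℂ] FockSpace Λ}
    (hf : f ∈ X.idealClosure) : creation u * f ∈ X.idealClosure := by
  have h : X.idealClosure ≤ X.idealClosure.comap (LinearMap.mulLeft ℂ (creation u)) := by
    refine Submodule.topologicalClosure_minimal _ (Submodule.span_le.2 ?_)
      (X.isClosed_idealClosure.preimage (continuous_const_mul (creation u)))
    rintro _ ⟨k, x, hx, rfl⟩
    change creation u * creation x ∈ X.idealClosure
    rw [← creation_tmul]
    exact X.creation_mem_idealClosure (X.tmul_mem_orthogonal_left u hx)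
  exact h hf

theorem mul_creation_mem {n : ℕ} (u : tensorPower Λ n) {f : FockSpace Λ →L[ℂ] FockSpace Λ}
    (hf : f ∈ X.idealClosure) : f * creation u ∈ X.idealClosure := by
  have h : X.idealClosure ≤ X.idealClosure.comap (LinearMap.mulRight ℂ (creation u)) := by
    refine Submodule.topologicalClosure_minimal _ (Submodule.span_le.2 ?_)
      (X.isClosed_idealClosure.preimage (continuous_mul_const (creation u)))
    rintro _ ⟨k, x, hx, rfl⟩
    change creation x * creation u ∈ X.idealClosure
    rw [← creation_tmul]
    exact X.creation_mem_idealClosure (X.tmul_mem_orthogonal_right hx u)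
  exact h hf

theorem mul_mem_idealClosure {f g : FockSpace Λ →L[ℂ] FockSpace Λ} (hf : f ∈ X.idealClosure)
    (hg : g ∈ discAlgebra Λ) : g * f ∈ X.idealClosure ∧ f * g ∈ X.idealClosure := by
  have key : ∀ g ∈ Algebra.adjoin ℂ (Set.range fun x : tensorPower Λ 1 => creation x),
      ∀ f ∈ X.idealClosure, g * f ∈ X.idealClosure ∧ f * g ∈ X.idealClosure := by
    intro g hg
    induction hg using Algebra.adjoin_induction with
    | mem g hg =>
      obtain ⟨x, rfl⟩ := hg
      exact fun f hf => ⟨X.creation_mul_mem x hf, X.mul_creation_mem x hf⟩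
    | algebraMap c =>
      intro f hf
      rw [← Algebra.commutes c f, and_self, ← Algebra.smul_def]
      exact X.idealClosure.smul_mem c hf
    | add a b _ _ ha hb =>
      intro f hf
      rw [add_mul, mul_add]
      exact ⟨X.idealClosure.add_mem (ha f hf).1 (hb f hf).1,
        X.idealClosure.add_mem (ha f hf).2 (hb f hf).2⟩
    | mul a b _ _ ha hb =>
      intro f hf
      rw [mul_assoc, ← mul_assoc f]
      exact ⟨(ha _ (hb f hf).1).1, (hb _ (ha f hf).2).2⟩
  have hg' : g ∈ closure (Algebra.adjoin ℂ
      (Set.range fun x : tensorPower Λ 1 => creation x) : Set (FockSpace Λ →L[ℂ] FockSpace Λ)) :=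
    hg
  refine closure_minimal (t := {g | g * f ∈ X.idealClosure ∧ f * g ∈ X.idealClosure})
    (fun a ha => key a ha f hf) ?_ hg'
  exact (X.isClosed_idealClosure.preimage (continuous_mul_const f)).inter
    (X.isClosed_idealClosure.preimage (continuous_const_mul f))

/-- The closed ideal `J_X` of `𝔄_d`, the norm closure of `∑ₙ H^{⊗n} ⊖ X_n`, with `x ∈ H^{⊗n}`
regarded as the element `L(x)` of `𝔄_d`. -/
def ideal : Ideal (discAlgebra Λ) where
  carrier := {f | (f : FockSpace Λ →L[ℂ] FockSpace Λ) ∈ X.idealClosure}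
  zero_mem' := X.idealClosure.zero_mem
  add_mem' := fun ha hb => X.idealClosure.add_mem ha hb
  smul_mem' := fun c _ hf => (X.mul_mem_idealClosure hf c.2).1

instance : X.ideal.IsTwoSided :=
  ⟨fun g hf => (X.mul_mem_idealClosure hf g.2).2⟩

end SubproductSystem

end

/-! Write P for the projection onto 𝓕_X. Since X_{m+k} ⊆ X_m ⊗ X_k, the complement 𝓕_X^⊥ is
invariant under every L(u), so compression is multiplicative on 𝔄_d, and L(x) with x ⊥ X_m maps the
whole Fock space into 𝓕_X^⊥, so J_X lies in the kernel. Compression is completely contractive. What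
remains is a lifting statement with norm control, `exists_lift`: for F in M_n(𝔄_d) and ε > 0 some T
in F + M_n(J_X) has norm at most that of the compression of F plus ε. With n = 1 and zero
compression it identifies the kernel with J_X; with n = 1 it also makes the range closed, hence
equal to 𝓐_X; for general n it is the complete isometry.

By density F may be taken to be a matrix of polynomials ∑ L(u_k). It commutes with the right shifts
R_i, which form a row isometry, and PF intertwines them with their compressions to 𝓕_X. Commutant
lifting would give an operator commuting with the R_i, but such an operator need not lie in 𝔄_d.
Instead the lifting is stopped at a finite stage. The spaces `truncation n N` increase from 𝓕_X^n by
releasing the constraint in degrees up to N, and the R_i^* carry stage N + 1 into stage N. Each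
stage is one application of Parrott's theorem (`exists_norm_completion`,
`IsIntertwining.exists_extension`). The operator at stage N agrees in degrees up to N with a
polynomial matrix whose coefficients satisfy t_k - u_k ⊥ X_k (`intertwining_apply_eq`).

Only the part of this polynomial matrix in degrees up to N is controlled. Its Cesàro mean, with
weights 1 - k/(N+1), is controlled globally: it is an average of compressions to windows of N + 1
consecutive degrees, all of which are amplifications or compressions of the controlled part
(`norm_cesaro_le`). The weights are then repaired by adding (N+1)⁻¹ ∑ k L(u_k), which tends to 0 as
N grows because u is fixed. -/

noncomputable section

/-! ### Parrott completion -/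

open ContinuousLinearMap in
/-- Parrott's completion theorem, in the form that the missing corner can be taken as `C ∘ M`. -/
theorem exists_norm_completion {H₁ H₂ K₁ K₂ : Type*}
    [NormedAddCommGroup H₁] [InnerProductSpace ℂ H₁] [CompleteSpace H₁]
    [NormedAddCommGroup H₂] [InnerProductSpace ℂ H₂]
    [NormedAddCommGroup K₁] [InnerProductSpace ℂ K₁] [CompleteSpace K₁]
    [NormedAddCommGroup K₂] [InnerProductSpace ℂ K₂]
    (A : H₁ →L[ℂ] K₁) (B : H₂ →L[ℂ] K₁) (C : H₁ →L[ℂ] K₂) {c : ℝ} (hc : ‖A‖ < c)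
    (hrow : ∀ x y, ‖A x + B y‖ ^ 2 ≤ c ^ 2 * (‖x‖ ^ 2 + ‖y‖ ^ 2))
    (hcol : ∀ x, ‖A x‖ ^ 2 + ‖C x‖ ^ 2 ≤ c ^ 2 * ‖x‖ ^ 2) :
    ∃ M : H₂ →L[ℂ] H₁, ∀ x y,
      ‖A x + B y‖ ^ 2 + ‖C (x + M y)‖ ^ 2 ≤ c ^ 2 * (‖x‖ ^ 2 + ‖y‖ ^ 2) := by
  have hc0 : 0 < c := (norm_nonneg A).trans_lt hc
  set T : H₁ →L[ℂ] H₁ := ((c ^ 2 : ℝ)⁻¹ : ℂ) • (A.adjoint ∘L A) with hT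
  have hT1 : ‖T‖ < 1 := by
    rw [hT, norm_smul, norm_adjoint_comp_self, norm_inv, Complex.norm_real, Real.norm_eq_abs,
      abs_of_pos (by positivity), inv_mul_lt_one₀ (by positivity)]
    nlinarith [norm_nonneg A]
  obtain ⟨u, hu⟩ := isUnit_one_sub_of_norm_lt_one hT1
  -- For fixed y, the form c²(‖x‖² + ‖y‖²) - ‖Ax + By‖² in x is critical at m with c²m = A*(Am +
  -- By), and M is y ↦ -m. The strict bound ‖A‖ < c makes c² - A*A invertible.
  refine ⟨-((↑u⁻¹ : H₁ →L[ℂ] H₁) ∘L (((c ^ 2 : ℝ)⁻¹ : ℂ) • (A.adjoint ∘L B))), fun x y => ?_⟩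
  set m : H₁ := (↑u⁻¹ : H₁ →L[ℂ] H₁) (((c ^ 2 : ℝ)⁻¹ : ℂ) • A.adjoint (B y)) with hm
  have hM : (-((↑u⁻¹ : H₁ →L[ℂ] H₁) ∘L (((c ^ 2 : ℝ)⁻¹ : ℂ) • (A.adjoint ∘L B)))) y = -m := rfl
  rw [hM, ← sub_eq_add_neg]
  have hG : m - T m = ((c ^ 2 : ℝ)⁻¹ : ℂ) • A.adjoint (B y) := by
    have h1 : (u : H₁ →L[ℂ] H₁) m = ((c ^ 2 : ℝ)⁻¹ : ℂ) • A.adjoint (B y) := by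
      rw [hm, ← mul_apply_eq_comp, Units.mul_inv, one_apply_eq_self]
    rw [← h1, hu]; rfl
  have hGm : ((c ^ 2 : ℝ) : ℂ) • m = A.adjoint (A m) + A.adjoint (B y) := by
    have hc2 : ((c ^ 2 : ℝ) : ℂ) ≠ 0 := by exact_mod_cast (by positivity : c ^ 2 ≠ 0)
    have h2 : m = ((c ^ 2 : ℝ)⁻¹ : ℂ) • A.adjoint (A m) + ((c ^ 2 : ℝ)⁻¹ : ℂ) • A.adjoint (B y) := by
      rw [← hG]; simp [hT]
    rw [← smul_add] at h2
    conv_lhs => rw [h2]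
    rw [smul_smul, mul_inv_cancel₀ hc2, one_smul]
  have key : ∀ z, c ^ 2 * (⟪z, m⟫_ℂ).re = (⟪A z, A m⟫_ℂ).re + (⟪A z, B y⟫_ℂ).re := by
    intro z
    have := congrArg (fun v => (⟪z, v⟫_ℂ).re) hGm
    simpa [inner_smul_right, inner_add_right, adjoint_inner_right, ← Complex.ofReal_pow] using this
  have k1 := key x
  -- Completing the square, the form at x is its value at m plus c²‖x - m‖² - ‖A(x - m)‖². The row
  -- condition makes the first term nonnegative and the column condition bounds the second below by
  -- ‖C(x - m)‖².
  have k2 := key m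
  have h1 := hrow m y
  have h2 := hcol (x - m)
  have e1 := norm_add_sq (𝕜 := ℂ) (A x) (B y)
  have e2 := norm_add_sq (𝕜 := ℂ) (A m) (B y)
  have e3 := norm_sub_sq (𝕜 := ℂ) x m
  have e4 := norm_sub_sq (𝕜 := ℂ) (A x) (A m)
  have e5 := inner_self_eq_norm_sq (𝕜 := ℂ) m
  have e6 := inner_self_eq_norm_sq (𝕜 := ℂ) (A m)
  rw [map_sub] at h2
  simp only [RCLike.re_to_complex] at e1 e2 e3 e4 e5 e6
  rw [e5, e6] at k2
  rw [e3, e4] at h2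
  rw [e2] at h1
  rw [e1]
  linarith

/-! ### Stepwise commutant lifting for row isometries -/

section Lifting

variable {ι E : Type*} [NormedAddCommGroup E] [InnerProductSpace ℂ E]

/-- The operator `⨁ B` on `⨁ E`. -/
def ampliation (ι : Type*) (B : E →L[ℂ] E) :
    lp (fun _ : ι => E) 2 →L[ℂ] lp (fun _ : ι => E) 2 :=
  lp.mapCLM 2 (K := ‖B‖) (fun _ => B) (norm_nonneg _) (fun _ => le_rfl)

theorem norm_ampliation_le (B : E →L[ℂ] E) : ‖ampliation ι B‖ ≤ ‖B‖ :=
  lp.norm_mapCLM_le _ _ _ _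

theorem ampliation_single [DecidableEq ι] (B : E →L[ℂ] E) (i : ι) (x : E) :
    ampliation ι B (lp.single 2 i x) = lp.single 2 i (B x) := by
  ext j
  change B ((lp.single 2 i x : lp (fun _ : ι => E) 2) j) = _
  by_cases h : j = i
  · subst h; simp
  · simp [h]

/-- `B` takes values in `Y` and intertwines the isometries `V i` with their compressions to `Y`. -/
structure IsIntertwining (V : ι → E →ₗᵢ[ℂ] E) (Y : Submodule ℂ E) [Y.HasOrthogonalProjection]
    (B : E →L[ℂ] E) : Prop where
  mem : ∀ x, B x ∈ Y
  apply_shift : ∀ i x, B (V i x) = Y.starProjection (V i (B x))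

/-- Testing against y in Y' moves V to V*y, which lies in Y and so does not see u - v. -/
theorem starProjection_isometry_eq [CompleteSpace E] {V : E →ₗᵢ[ℂ] E} {Y Y' : Submodule ℂ E}
    [Y'.HasOrthogonalProjection]
    (hVY : ∀ y ∈ Y', V.toContinuousLinearMap.adjoint y ∈ Y) {u v : E} (h : u - v ∈ Yᗮ) :
    Y'.starProjection (V u) = Y'.starProjection (V v) := by
  rw [← sub_eq_zero, ← map_sub, ← map_sub, Submodule.starProjection_apply_eq_zero_iff,
    Submodule.mem_orthogonal]
  intro y hy
  have := ContinuousLinearMap.adjoint_inner_left V.toContinuousLinearMap (u - v) y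
  rw [LinearIsometry.coe_toContinuousLinearMap] at this
  rw [← this]
  exact (Submodule.mem_orthogonal _ _).1 h _ (hVY y hy)

theorem norm_add_sq_of_mem_orthogonal {Y : Submodule ℂ E} {u v : E} (hu : u ∈ Y) (hv : v ∈ Yᗮ) :
    ‖u + v‖ ^ 2 = ‖u‖ ^ 2 + ‖v‖ ^ 2 := by
  rw [norm_add_sq (𝕜 := ℂ), (Submodule.mem_orthogonal _ _).1 hv u hu]; simp

/-- One step of commutant lifting. Because the adjoints carry Y' into Y, the intertwining relation
for B' involves only B on its right-hand side. It therefore prescribes the new component of B' on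
the ranges of the V i and leaves it free on their common orthogonal complement, where Parrott's
theorem chooses it. -/
theorem IsIntertwining.exists_extension [CompleteSpace E] {V : ι → E →ₗᵢ[ℂ] E}
    (hV : OrthogonalFamily ℂ (fun _ : ι => E) V) {Y Y' : Submodule ℂ E}
    [Y.HasOrthogonalProjection] [Y'.HasOrthogonalProjection] (hY : Y ≤ Y')
    (hVY : ∀ i, ∀ y ∈ Y', (V i).toContinuousLinearMap.adjoint y ∈ Y) {B : E →L[ℂ] E}
    (hB : IsIntertwining V Y B) {c : ℝ} (hc : ‖B‖ < c) :
    ∃ B' : E →L[ℂ] E, IsIntertwining V Y' B' ∧ ‖B'‖ < c ∧ ∀ x, Y.starProjection (B' x) = B x := by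
  classical
  -- Parrott needs a strict bound and returns a weak one; the intermediate constant keeps the
  -- conclusion strict, so that the step can be iterated.
  obtain ⟨c', hBc', hc'⟩ := exists_between hc
  have hc0 : 0 < c' := (norm_nonneg B).trans_lt hBc'
  set U := hV.linearIsometry.toContinuousLinearMap with hU
  have hUs : ∀ i x, U (lp.single 2 i x) = V i x := fun i x => hV.linearIsometry_apply_single x
  have hUn : ∀ z, ‖U z‖ = ‖z‖ := fun z => hV.linearIsometry.norm_map z
  have hUU : ∀ z, U.adjoint (U z) = z := by
    intro z
    refine ext_inner_right ℂ fun w => ?_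
    rw [ContinuousLinearMap.adjoint_inner_left]
    exact hV.linearIsometry.inner_map_map z w
  have horth : ∀ z y, ⟪U z, y - U (U.adjoint y)⟫_ℂ = 0 := by
    intro z y
    rw [← ContinuousLinearMap.adjoint_inner_right, map_sub, hUU, sub_self, inner_zero_right]
  have hpyth : ∀ z y, ‖U z + (y - U (U.adjoint y))‖ ^ 2 =
      ‖z‖ ^ 2 + ‖y - U (U.adjoint y)‖ ^ 2 := by
    intro z y
    rw [norm_add_sq (𝕜 := ℂ), horth, hUn]; simp
  have hcontr : ∀ y, ‖y - U (U.adjoint y)‖ ^ 2 ≤ ‖y‖ ^ 2 := by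
    intro y
    have := hpyth (U.adjoint y) y
    rw [add_sub_cancel] at this
    nlinarith [sq_nonneg ‖U.adjoint y‖]
  have hBU : B ∘L U = Y.starProjection ∘L U ∘L ampliation ι B := by
    refine lp.ext_continuousLinearMap (by norm_num) fun i => ?_
    ext x
    simp only [ContinuousLinearMap.comp_apply, lp.singleContinuousLinearMap_apply,
      ampliation_single, hUs, hB.apply_shift]
  have hBU' : ∀ z, B (U z) = Y.starProjection (U (ampliation ι B z)) :=
    fun z => DFunLike.congr_fun hBU z
  set Q : E →L[ℂ] E := ContinuousLinearMap.id ℂ E - U ∘L U.adjoint with hQ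
  have hQa : ∀ y, Q y = y - U (U.adjoint y) := fun y => rfl
  -- The forced component of B' in Y' ⊖ Y on the range of U.
  set C := (Y'.starProjection - Y.starProjection) ∘L U ∘L ampliation ι B with hC
  have hproj : ∀ z, Y'.starProjection z - Y.starProjection z ∈ Yᗮ := by
    intro z
    have h1 := Submodule.sub_starProjection_mem_orthogonal (K := Y) z
    have h2 := Submodule.orthogonal_le hY (Submodule.sub_starProjection_mem_orthogonal (K := Y') z)
    have := Submodule.sub_mem _ h1 h2
    rwa [sub_sub_sub_cancel_left] at this
  have hCmem : ∀ z, C z ∈ Yᗮ := fun z => hproj _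
  have hCmem' : ∀ z, C z ∈ Y' := fun z =>
    Submodule.sub_mem _ (Submodule.starProjection_apply_mem _ _)
      (hY (Submodule.starProjection_apply_mem _ _))
  have hampl : ∀ z, ‖ampliation ι B z‖ ≤ c' * ‖z‖ := fun z =>
    (ContinuousLinearMap.le_of_opNorm_le _ (norm_ampliation_le B) z).trans
      (mul_le_mul_of_nonneg_right hBc'.le (norm_nonneg _))
  have hBn : ∀ z, ‖B z‖ ≤ c' * ‖z‖ := fun z => ContinuousLinearMap.le_of_opNorm_le _ hBc'.le z
  -- The source splits as ran U ⊕ ker U*, with Q the projection onto ker U*. The row is B itself;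
  -- the column is P_{Y'} U(⨁ B), whose part in Y is BU by the intertwining relation.
  obtain ⟨M, hM⟩ := exists_norm_completion (B ∘L U) (B ∘L Q) C (c := c') (by
      refine lt_of_le_of_lt ((B ∘L U).opNorm_le_bound (norm_nonneg B) fun z => ?_) hBc'
      rw [ContinuousLinearMap.comp_apply, ← hUn z]
      exact B.le_opNorm _)
    (by
      intro x y
      simp only [ContinuousLinearMap.comp_apply, hQa]
      rw [← map_add]
      have h1 := pow_le_pow_left₀ (norm_nonneg _) (hBn (U x + (y - U (U.adjoint y)))) 2
      rw [mul_pow, hpyth] at h1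
      nlinarith [hcontr y, sq_nonneg c'])
    (by
      intro x
      have h0 : ‖B (U x)‖ ^ 2 + ‖C x‖ ^ 2 = ‖Y'.starProjection (U (ampliation ι B x))‖ ^ 2 := by
        rw [hBU', ← norm_add_sq_of_mem_orthogonal (Submodule.starProjection_apply_mem _ _) (hCmem x)]
        simp [hC]
      have h1 : ‖Y'.starProjection (U (ampliation ι B x))‖ ≤ c' * ‖x‖ :=
        ((Y'.norm_starProjection_apply_le _).trans_eq (hUn _)).trans (hampl x)
      rw [ContinuousLinearMap.comp_apply, h0, ← mul_pow]
      exact pow_le_pow_left₀ (norm_nonneg _) h1 2)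
  set B' : E →L[ℂ] E := B + C ∘L (U.adjoint + M ∘L Q) with hB'
  have hB'a : ∀ x, B' x = B x + C (U.adjoint x + M (Q x)) := fun x => rfl
  have hBB' : ∀ x, B' x - B x ∈ Yᗮ := fun x => by
    rw [hB'a, add_sub_cancel_left]; exact hCmem _
  refine ⟨B', ⟨fun x => ?_, fun i x => ?_⟩, ?_, fun x => ?_⟩
  · exact Submodule.add_mem _ (hY (hB.mem x)) (hCmem' _)
  -- On V i x the free part vanishes, since Q kills ran U; the Y part and the forced part add up to
  -- P_{Y'} V i (B x), which equals P_{Y'} V i (B' x).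
  · rw [starProjection_isometry_eq (hVY i) (hBB' x), hB'a, ← hUs, hUU, hQa, hUU, sub_self, map_zero,
      add_zero, hC]
    simp only [ContinuousLinearMap.comp_apply, ampliation_single, hUs, hB.apply_shift]
    simp
  · refine (B'.opNorm_le_bound hc0.le fun x => ?_).trans_lt hc'
    refine (pow_le_pow_iff_left₀ (norm_nonneg _) (by positivity) two_ne_zero).1 ?_
    have h1 := hM (U.adjoint x) (Q x)
    have h2 : U.adjoint (Q x) = 0 := by rw [hQa, map_sub, hUU, sub_self]
    have h3 : Q (Q x) = Q x := by rw [hQa, h2, map_zero, sub_zero]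
    have h4 := hpyth (U.adjoint x) x
    rw [add_sub_cancel] at h4
    rw [ContinuousLinearMap.comp_apply, ContinuousLinearMap.comp_apply, h3, ← map_add, hQa,
      add_sub_cancel, ← h4, ← hQa] at h1
    rw [hB'a, norm_add_sq_of_mem_orthogonal (hB.mem x) (hCmem _), mul_pow]
    exact h1
  · rw [hB'a, map_add, (Submodule.starProjection_eq_self_iff).2 (hB.mem x),
      (Submodule.starProjection_apply_eq_zero_iff _).2 (hCmem _), add_zero]

/-- Iterates the one-step extension from P_{Y 0} F. Each step leaves the projection to the previous
space unchanged, so the projection to Y 0 remains that of F. -/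
theorem exists_isIntertwining [CompleteSpace E] {V : ι → E →ₗᵢ[ℂ] E}
    (hV : OrthogonalFamily ℂ (fun _ : ι => E) V) {Y : ℕ → Submodule ℂ E}
    [∀ N, (Y N).HasOrthogonalProjection] (hY : ∀ N, Y N ≤ Y (N + 1))
    (hY0 : ∀ i, ∀ y ∈ Y 0, (V i).toContinuousLinearMap.adjoint y ∈ Y 0)
    (hVY : ∀ N i, ∀ y ∈ Y (N + 1), (V i).toContinuousLinearMap.adjoint y ∈ Y N) {F : E →L[ℂ] E}
    (hF : ∀ i x, F (V i x) = V i (F x)) {c : ℝ} (hc : ‖(Y 0).starProjection ∘L F‖ < c) (N : ℕ) :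
    ∃ B : E →L[ℂ] E, IsIntertwining V (Y N) B ∧ ‖B‖ < c ∧
      ∀ x, (Y 0).starProjection (B x) = (Y 0).starProjection (F x) := by
  induction N with
  | zero =>
    refine ⟨(Y 0).starProjection ∘L F, ⟨fun x => Submodule.starProjection_apply_mem _ _,
      fun i x => ?_⟩, hc, fun x => ?_⟩
    · rw [ContinuousLinearMap.comp_apply, hF]
      refine starProjection_isometry_eq (hY0 i) ?_
      exact Submodule.sub_starProjection_mem_orthogonal _
    · exact Submodule.starProjection_eq_self_iff.2 (Submodule.starProjection_apply_mem _ _)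
  | succ N ih =>
    obtain ⟨B, hB, hBc, hBF⟩ := ih
    obtain ⟨B', hB', hBc', hBB'⟩ := hB.exists_extension hV (hY N) (hVY N) hBc
    refine ⟨B', hB', hBc', fun x => ?_⟩
    have hle : Y 0 ≤ Y N := monotone_nat_of_le_succ hY (Nat.zero_le N)
    rw [← hBF, ← hBB' x]
    rw [← sub_eq_zero, ← map_sub, Submodule.starProjection_apply_eq_zero_iff]
    exact Submodule.orthogonal_le hle (Submodule.sub_starProjection_mem_orthogonal _)

end Lifting

/-! ### Diagonal operators on direct sums -/

section Diagonal

variable {E K : Type*} [NormedAddCommGroup E] [InnerProductSpace ℂ E]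
  [NormedAddCommGroup K] [InnerProductSpace ℂ K]

/-- The operator `f ⊕ ⋯ ⊕ f` on the direct sum of `n` copies. -/
def diagOperator (n : ℕ) (f : E →L[ℂ] K) :
    PiLp 2 (fun _ : Fin n => E) →L[ℂ] PiLp 2 (fun _ : Fin n => K) :=
  (PiLp.continuousLinearEquiv 2 ℂ (fun _ : Fin n => K)).symm.toContinuousLinearMap ∘L
    ContinuousLinearMap.pi fun i => f ∘L PiLp.proj 2 (fun _ : Fin n => E) i

@[simp] theorem diagOperator_apply {n : ℕ} (f : E →L[ℂ] K) (x : PiLp 2 (fun _ : Fin n => E))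
    (i : Fin n) : diagOperator n f x i = f (x i) := rfl

theorem matrixOperator_apply {n : ℕ} (T : Matrix (Fin n) (Fin n) (E →L[ℂ] E))
    (x : PiLp 2 (fun _ : Fin n => E)) (i : Fin n) :
    matrixOperator T x i = ∑ j, T i j (x j) := by
  simp [matrixOperator]

theorem norm_diagOperator_apply_le {n : ℕ} {f : E →L[ℂ] K} (hf : ∀ v, ‖f v‖ ≤ ‖v‖)
    (x : PiLp 2 (fun _ : Fin n => E)) : ‖diagOperator n f x‖ ≤ ‖x‖ := by
  refine (sq_le_sq₀ (norm_nonneg _) (norm_nonneg _)).1 ?_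
  rw [PiLp.norm_sq_eq_of_L2, PiLp.norm_sq_eq_of_L2]
  exact Finset.sum_le_sum fun i _ => pow_le_pow_left₀ (norm_nonneg _) (hf _) 2

/-- The isometry `V ⊕ ⋯ ⊕ V` on the direct sum of `n` copies. -/
def diagIsometry (n : ℕ) (V : E →ₗᵢ[ℂ] K) :
    PiLp 2 (fun _ : Fin n => E) →ₗᵢ[ℂ] PiLp 2 (fun _ : Fin n => K) where
  toLinearMap := (diagOperator n V.toContinuousLinearMap).toLinearMap
  norm_map' x := by
    refine (sq_eq_sq₀ (norm_nonneg _) (norm_nonneg _)).1 ?_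
    rw [PiLp.norm_sq_eq_of_L2, PiLp.norm_sq_eq_of_L2]
    exact Finset.sum_congr rfl fun i _ => by simp

@[simp] theorem diagIsometry_apply {n : ℕ} (V : E →ₗᵢ[ℂ] K) (x : PiLp 2 (fun _ : Fin n => E))
    (i : Fin n) : diagIsometry n V x i = V (x i) := rfl

theorem adjoint_diagIsometry_apply [CompleteSpace E] [CompleteSpace K] {n : ℕ} (V : E →ₗᵢ[ℂ] K)
    (x : PiLp 2 (fun _ : Fin n => K)) (i : Fin n) :
    (diagIsometry n V).toContinuousLinearMap.adjoint x i =
      V.toContinuousLinearMap.adjoint (x i) := by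
  suffices (diagIsometry n V).toContinuousLinearMap.adjoint x =
      diagOperator n V.toContinuousLinearMap.adjoint x by rw [this, diagOperator_apply]
  refine ext_inner_right ℂ fun y => ?_
  rw [ContinuousLinearMap.adjoint_inner_left, PiLp.inner_apply, PiLp.inner_apply]
  refine Finset.sum_congr rfl fun j _ => ?_
  rw [diagOperator_apply, ContinuousLinearMap.adjoint_inner_left]
  rfl

theorem matrixOperator_diagIsometry {n : ℕ} {T : Matrix (Fin n) (Fin n) (E →L[ℂ] E)}
    {V : E →ₗᵢ[ℂ] E} (h : ∀ i j x, T i j (V x) = V (T i j x)) (x : PiLp 2 (fun _ : Fin n => E)) :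
    matrixOperator T (diagIsometry n V x) = diagIsometry n V (matrixOperator T x) := by
  ext i
  simp [matrixOperator_apply, h]

theorem norm_matrixOperator_le {n : ℕ} (T : Matrix (Fin n) (Fin n) (E →L[ℂ] E)) :
    ‖matrixOperator T‖ ≤ ∑ i, ∑ j, ‖T i j‖ := by
  have h0 : 0 ≤ ∑ i, ∑ j, ‖T i j‖ := by positivity
  refine ContinuousLinearMap.opNorm_le_bound _ h0 fun x => ?_
  have h1 : ‖matrixOperator T x‖ ≤ ∑ i, ‖matrixOperator T x i‖ := by
    refine (sq_le_sq₀ (norm_nonneg _) (by positivity)).1 ?_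
    rw [PiLp.norm_sq_eq_of_L2]
    exact Finset.sum_sq_le_sq_sum_of_nonneg fun i _ => norm_nonneg _
  refine h1.trans ?_
  rw [Finset.sum_mul]
  refine Finset.sum_le_sum fun i _ => ?_
  rw [matrixOperator_apply, Finset.sum_mul]
  refine norm_sum_le_of_le _ fun j _ => ?_
  exact ((T i j).le_opNorm _).trans
    (mul_le_mul_of_nonneg_left (PiLp.norm_apply_le x j) (norm_nonneg _))

theorem matrixOperator_add {n : ℕ} (S T : Matrix (Fin n) (Fin n) (E →L[ℂ] E)) :
    matrixOperator (S + T) = matrixOperator S + matrixOperator T := by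
  ext x i
  simp [matrixOperator_apply, Finset.sum_add_distrib]

end Diagonal

/-! ### Words, degrees and the right shifts -/

namespace FockSpace

variable {Λ : Type*}

@[simp] theorem sub_apply (u v : FockSpace Λ) (w : List Λ) : (u - v) w = u w - v w := rfl

/-- Evaluation of the coefficient at a word. -/
def coeff (w : List Λ) : FockSpace Λ →L[ℂ] ℂ :=
  lp.evalCLM ℂ (fun _ : List Λ => ℂ) (p := 2) w

@[simp] theorem coeff_apply (w : List Λ) (v : FockSpace Λ) : coeff w v = v w := rfl

open Classical in
/-- The basis vector `e_{i₁} ⊗ ⋯ ⊗ e_{iₙ}` of the word `i₁ ⋯ iₙ`. -/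
def word (w : List Λ) : FockSpace Λ := lp.single (E := fun _ : List Λ => ℂ) 2 w 1

open Classical in
theorem word_apply (w w' : List Λ) : word w w' = if w' = w then 1 else 0 := by
  change (lp.single (E := fun _ : List Λ => ℂ) 2 w 1 : List Λ → ℂ) w' = _
  rw [lp.single_apply]
  simp [Pi.single_apply]

theorem inner_word (w : List Λ) (v : FockSpace Λ) : ⟪word w, v⟫_ℂ = v w := by
  classical
  have := lp.inner_single_left (𝕜 := ℂ) (G := fun _ : List Λ => ℂ) w 1 v
  refine Eq.trans ?_ (this.trans ?_)
  · rfl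
  · rw [RCLike.inner_apply, map_one, mul_one]

theorem ext_continuousLinearMap {F : Type*} [NormedAddCommGroup F] [NormedSpace ℂ F]
    {f g : FockSpace Λ →L[ℂ] F} (h : ∀ w, f (word w) = g (word w)) : f = g := by
  classical
  refine lp.ext_continuousLinearMap (E := fun _ : List Λ => ℂ) (p := 2) (by norm_num) fun w => ?_
  ext
  convert! h w

theorem norm_sq_eq_tsum (v : FockSpace Λ) : ‖v‖ ^ 2 = ∑' w, ‖v w‖ ^ 2 := by
  have := lp.norm_rpow_eq_tsum (E := fun _ : List Λ => ℂ) (p := 2) (by norm_num) v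
  simp only [ENNReal.toReal_ofNat, Real.rpow_ofNat] at this
  exact this

/-- The projection onto the span of the words with length in `s`. -/
def degreeProj (s : Set ℕ) [DecidablePred (· ∈ s)] : FockSpace Λ →L[ℂ] FockSpace Λ :=
  lp.mapCLM (E := fun _ : List Λ => ℂ) (F := fun _ : List Λ => ℂ) 2 (K := 1)
    (fun w => if w.length ∈ s then ContinuousLinearMap.id ℂ ℂ else 0) zero_le_one
    (fun w => by split_ifs <;> simp)

theorem degreeProj_apply (s : Set ℕ) [DecidablePred (· ∈ s)] (v : FockSpace Λ) (w : List Λ) :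
    degreeProj s v w = if w.length ∈ s then v w else 0 := by
  change (if w.length ∈ s then ContinuousLinearMap.id ℂ ℂ else 0 : ℂ →L[ℂ] ℂ) (v w) = _
  split_ifs <;> simp

theorem norm_degreeProj_le (s : Set ℕ) [DecidablePred (· ∈ s)] (v : FockSpace Λ) :
    ‖degreeProj s v‖ ≤ ‖v‖ := by
  refine (ContinuousLinearMap.le_of_opNorm_le _ (lp.norm_mapCLM_le _ _ _ _) v).trans_eq (one_mul _)

theorem memℓp_extend (v : FockSpace Λ) (i : Λ) :
    Memℓp (Function.extend (fun w : List Λ => w ++ [i]) (fun w => v w) 0 : List Λ → ℂ) 2 := by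
  have hinj : Function.Injective (fun w : List Λ => w ++ [i]) := List.append_left_injective _
  apply memℓp_gen
  have := (summable_extend_zero hinj).2 v.summable_sq
  refine this.congr fun w => ?_
  by_cases hw : ∃ w', w' ++ [i] = w
  · obtain ⟨w', rfl⟩ := hw
    have e1 := hinj.extend_apply (fun w => ‖v w‖ ^ 2) 0 w'
    have e2 := hinj.extend_apply (fun w => v w) 0 w'
    simp only at e1 e2
    rw [e1, e2]; simp
  · rw [Function.extend_apply' _ _ _ hw, Function.extend_apply' _ _ _ hw]; simp

theorem extend_append_apply (v : List Λ → ℂ) (i : Λ) (w : List Λ) :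
    Function.extend (fun w : List Λ => w ++ [i]) v 0 (w ++ [i]) = v w :=
  (List.append_left_injective [i]).extend_apply v 0 w

/-- The right shift `v ↦ v ⊗ e_i`. -/
def rightShift (i : Λ) : FockSpace Λ →ₗᵢ[ℂ] FockSpace Λ where
  toFun v := ⟨Function.extend (fun w : List Λ => w ++ [i]) (fun w => v w) 0, memℓp_extend v i⟩
  map_add' u v := by
    ext w
    change Function.extend (fun w : List Λ => w ++ [i]) (fun w => (u + v) w) (0 : List Λ → ℂ) w =
      Function.extend (fun w : List Λ => w ++ [i]) (fun w => u w) (0 : List Λ → ℂ) w +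
        Function.extend (fun w : List Λ => w ++ [i]) (fun w => v w) (0 : List Λ → ℂ) w
    by_cases hw : ∃ w', w' ++ [i] = w
    · obtain ⟨w', rfl⟩ := hw
      simp only [extend_append_apply, add_apply]
    · simp [Function.extend_apply' _ _ _ hw]
  map_smul' c v := by
    ext w
    change Function.extend (fun w : List Λ => w ++ [i]) (fun w => (c • v) w) (0 : List Λ → ℂ) w =
      c * Function.extend (fun w : List Λ => w ++ [i]) (fun w => v w) (0 : List Λ → ℂ) w
    by_cases hw : ∃ w', w' ++ [i] = w
    · obtain ⟨w', rfl⟩ := hw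
      simp only [extend_append_apply, smul_apply]
    · simp [Function.extend_apply' _ _ _ hw]
  norm_map' v := by
    refine (sq_eq_sq₀ (norm_nonneg _) (norm_nonneg _)).1 ?_
    rw [norm_sq_eq_tsum, norm_sq_eq_tsum]
    change ∑' w, ‖Function.extend (fun w : List Λ => w ++ [i]) (fun w => v w)
      (0 : List Λ → ℂ) w‖ ^ 2 = ∑' w, ‖v w‖ ^ 2
    rw [← (List.append_left_injective [i]).tsum_eq]
    · simp only [extend_append_apply]
    · intro w hw
      by_contra hw'
      refine hw ?_
      change ‖Function.extend (fun w : List Λ => w ++ [i]) _ _ w‖ ^ 2 = 0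
      rw [Function.extend_apply' _ _ _ hw']; simp

@[simp] theorem rightShift_nil (i : Λ) (v : FockSpace Λ) : rightShift i v [] = 0 :=
  Function.extend_apply' _ _ _ (by simp)

@[simp] theorem rightShift_append_self (i : Λ) (v : FockSpace Λ) (w : List Λ) :
    rightShift i v (w ++ [i]) = v w :=
  extend_append_apply _ i w

theorem rightShift_append_ne {i j : Λ} (h : i ≠ j) (v : FockSpace Λ) (w : List Λ) :
    rightShift i v (w ++ [j]) = 0 :=
  Function.extend_apply' _ _ _ (by simp [h])

theorem rightShift_word (i : Λ) (w : List Λ) : rightShift i (word w) = word (w ++ [i]) := by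
  classical
  ext w'
  induction w' using List.reverseRecOn with
  | nil => simp [word_apply]
  | append_singleton w' j _ =>
    by_cases h : i = j
    · subst h; simp [word_apply]
    · rw [rightShift_append_ne h, word_apply, if_neg]
      simp [Ne.symm h]

theorem adjoint_rightShift_apply (i : Λ) (v : FockSpace Λ) (w : List Λ) :
    (rightShift i).toContinuousLinearMap.adjoint v w = v (w ++ [i]) := by
  rw [← inner_word, ContinuousLinearMap.adjoint_inner_right, LinearIsometry.coe_toContinuousLinearMap,
    rightShift_word, inner_word]

theorem inner_rightShift_of_ne {i j : Λ} (h : i ≠ j) (u v : FockSpace Λ) :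
    ⟪rightShift i u, rightShift j v⟫_ℂ = 0 := by
  rw [inner_eq_tsum]
  refine (tsum_congr fun w => ?_).trans tsum_zero
  induction w using List.reverseRecOn with
  | nil => simp
  | append_singleton w k _ =>
    by_cases hk : i = k
    · subst hk; rw [rightShift_append_ne h.symm, inner_zero_right]
    · rw [rightShift_append_ne hk, inner_zero_left]

theorem orthogonalFamily_rightShift (Λ : Type*) (n : ℕ) :
    OrthogonalFamily ℂ (fun _ : Λ => PiLp 2 fun _ : Fin n => FockSpace Λ)
      fun i => diagIsometry n (rightShift i) := by
  intro i j h u v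
  rw [PiLp.inner_apply]
  exact Finset.sum_eq_zero fun a _ => inner_rightShift_of_ne h _ _

theorem degreeProj_mem_tensorPower (k : ℕ) (v : FockSpace Λ) :
    degreeProj {k} v ∈ tensorPower Λ k := fun w hw => by
  rw [degreeProj_apply, if_neg (by simpa using hw)]

/-- The component of degree `k`. -/
def component (k : ℕ) : FockSpace Λ →L[ℂ] tensorPower Λ k :=
  (degreeProj {k}).codRestrict _ (degreeProj_mem_tensorPower k)

theorem component_apply (k : ℕ) (v : FockSpace Λ) (w : List Λ) :
    (component k v : FockSpace Λ) w = if w.length = k then v w else 0 := by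
  change degreeProj {k} v w = _
  simp [degreeProj_apply]

theorem component_apply_length (v : FockSpace Λ) (w : List Λ) :
    (component w.length v : FockSpace Λ) w = v w := by
  rw [component_apply, if_pos rfl]

theorem inner_component_left {k : ℕ} (v : FockSpace Λ) (x : tensorPower Λ k) :
    ⟪component k v, x⟫_ℂ = ⟪v, (x : FockSpace Λ)⟫_ℂ := by
  rw [Submodule.coe_inner, inner_eq_tsum, inner_eq_tsum]
  refine tsum_congr fun w => ?_
  rw [component_apply]
  split_ifs with h
  · rfl
  · rw [x.2 w h, inner_zero_right, inner_zero_right]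

theorem component_coe {k : ℕ} (x : tensorPower Λ k) : component k (x : FockSpace Λ) = x := by
  ext w
  rw [component_apply]
  split_ifs with h
  · rfl
  · rw [x.2 w h]

theorem component_coe_of_ne {k l : ℕ} (h : l ≠ k) (x : tensorPower Λ l) :
    component k (x : FockSpace Λ) = 0 := by
  ext w
  rw [component_apply]
  split_ifs with hw
  · rw [x.2 w (by omega)]; rfl
  · rfl

theorem component_tensor_add {m : ℕ} (k : ℕ) (u : tensorPower Λ m) (v : FockSpace Λ) :
    component (m + k) (tensor u v) = tmul u (component k v) := by
  ext w
  change _ = (u : FockSpace Λ) (w.take m) * (component k v : FockSpace Λ) (w.drop m)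
  rw [component_apply, component_apply, tensor_apply]
  by_cases h : (w.take m).length = m
  · have : w.length = m + k ↔ (w.drop m).length = k := by simp at h ⊢; omega
    simp only [this, mul_ite, mul_zero]
  · rw [u.2 _ h, zero_mul, zero_mul, ite_self]

theorem component_tensor_of_lt {m k : ℕ} (h : k < m) (u : tensorPower Λ m) (v : FockSpace Λ) :
    component k (tensor u v) = 0 := by
  ext w
  rw [component_apply, tensor_apply]
  split_ifs with hw
  · rw [u.2 _ (by simp; omega), zero_mul]; rfl
  · rfl

/-- Associativity of the tensor product: left creation commutes with right shifts. This puts 𝔄_d in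
the commutant of the right shifts and is what makes lifting applicable. -/
theorem tensor_rightShift {m : ℕ} (u : tensorPower Λ m) (i : Λ) (v : FockSpace Λ) :
    tensor u (rightShift i v) = rightShift i (tensor u v) := by
  ext w
  induction w using List.reverseRecOn with
  | nil => rw [tensor_apply, List.drop_nil, rightShift_nil, rightShift_nil, mul_zero]
  | append_singleton w j _ =>
    rw [tensor_apply]
    by_cases hm : m ≤ w.length
    · rw [List.take_append_of_le_length hm, List.drop_append_of_le_length hm]
      by_cases h : i = j
      · subst h; simp [tensor_apply]
      · rw [rightShift_append_ne h, rightShift_append_ne h, mul_zero]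
    · rw [List.drop_of_length_le (by simp; omega), rightShift_nil, mul_zero]
      by_cases h : i = j
      · subst h
        rw [rightShift_append_self, tensor_apply, u.2 (w.take m) (by simp; omega), zero_mul]
      · rw [rightShift_append_ne h]

end FockSpace

open FockSpace

/-! ### Creation operators and polynomials -/

section ClosedAlgebra

variable {E : Type*} [NormedAddCommGroup E] [InnerProductSpace ℂ E]

theorem isClosed_closedAlgebra (s : Set (E →L[ℂ] E)) : IsClosed (closedAlgebra s : Set (E →L[ℂ] E)) :=
  Subalgebra.isClosed_topologicalClosure _

theorem adjoin_le_closedAlgebra (s : Set (E →L[ℂ] E)) : Algebra.adjoin ℂ s ≤ closedAlgebra s :=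
  Subalgebra.le_topologicalClosure _

theorem closedAlgebra_le {s : Set (E →L[ℂ] E)} {A : Subalgebra ℂ (E →L[ℂ] E)} (hs : s ⊆ A)
    (hA : IsClosed (A : Set (E →L[ℂ] E))) : closedAlgebra s ≤ A :=
  Subalgebra.topologicalClosure_minimal (Algebra.adjoin_le hs) hA

theorem mem_closure_adjoin {s : Set (E →L[ℂ] E)} {f : E →L[ℂ] E} (hf : f ∈ closedAlgebra s) :
    f ∈ closure (Algebra.adjoin ℂ s : Set (E →L[ℂ] E)) :=
  hf

end ClosedAlgebra

section Polynomial

variable {Λ : Type*}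

theorem eq_top_of_word_mem {K : Submodule ℂ (FockSpace Λ)}
    (hK : IsClosed (K : Set (FockSpace Λ))) (h : ∀ w, word w ∈ K) : K = ⊤ := by
  have := hK.completeSpace_coe
  refine Submodule.eq_top_iff'.2 fun v => Submodule.starProjection_eq_self_iff.1 ?_
  have h1 : K.starProjection = ContinuousLinearMap.id ℂ _ :=
    FockSpace.ext_continuousLinearMap fun w => Submodule.starProjection_eq_self_iff.2 (h w)
  rw [h1, ContinuousLinearMap.id_apply]

/-- The map `u ↦ L(u)` on `H^{⊗n}`. -/
def creationCLM (Λ : Type*) (n : ℕ) : tensorPower Λ n →L[ℂ] FockSpace Λ →L[ℂ] FockSpace Λ :=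
  LinearMap.mkContinuous
    { toFun := creation
      map_add' := fun u v => by
        ext z w
        simp [creation_apply, tensor_apply, add_mul]
      map_smul' := fun c u => by
        ext z w
        simp [creation_apply, tensor_apply, mul_assoc] }
    1 fun u => by
      rw [one_mul]
      exact ContinuousLinearMap.opNorm_le_bound _ (norm_nonneg _) fun v => (norm_tensor u v).le

theorem creation_zero (n : ℕ) : creation (0 : tensorPower Λ n) = 0 := (creationCLM Λ n).map_zero

theorem creation_add {n : ℕ} (u v : tensorPower Λ n) :
    creation (u + v) = creation u + creation v := (creationCLM Λ n).map_add u v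

theorem creation_sub {n : ℕ} (u v : tensorPower Λ n) :
    creation (u - v) = creation u - creation v := (creationCLM Λ n).map_sub u v

theorem creation_smul {n : ℕ} (c : ℂ) (u : tensorPower Λ n) :
    creation (c • u) = c • creation u := (creationCLM Λ n).map_smul c u

theorem creation_congr {m n : ℕ} (h : m = n) {u : tensorPower Λ m} {v : tensorPower Λ n}
    (huv : (u : FockSpace Λ) = v) : creation u = creation v := by
  subst h
  rw [Subtype.ext huv]

theorem word_mem_tensorPower (w : List Λ) : word w ∈ tensorPower Λ w.length := fun w' h => by
  classical
  rw [word_apply, if_neg (by rintro rfl; exact h rfl)]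

theorem tensor_word (i : Λ) (w : List Λ) :
    tensor (⟨word [i], word_mem_tensorPower [i]⟩ : tensorPower Λ 1) (word w) = word (i :: w) := by
  classical
  ext w'
  rw [tensor_apply]
  change word [i] _ * _ = _
  rcases w' with _ | ⟨j, w'⟩
  · simp [word_apply]
  · simp only [word_apply]
    by_cases h : j = i <;> simp [h]

theorem creation_word_mem_adjoin (w : List Λ) :
    creation (⟨word w, word_mem_tensorPower w⟩ : tensorPower Λ w.length) ∈
      Algebra.adjoin ℂ (Set.range fun x : tensorPower Λ 1 => creation x) := by
  classical
  induction w with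
  | nil =>
    have h : creation (⟨word [], word_mem_tensorPower []⟩ : tensorPower Λ 0) = 1 := by
      ext v w
      change word [] _ * v w = v w
      simp [word_apply]
    exact h ▸ one_mem _
  | cons i w ih =>
    have h := creation_tmul (⟨word [i], word_mem_tensorPower [i]⟩ : tensorPower Λ 1)
      (⟨word w, word_mem_tensorPower w⟩ : tensorPower Λ w.length)
    rw [creation_congr (n := (i :: w).length) (v := ⟨word (i :: w), word_mem_tensorPower _⟩)
      (by simp [add_comm]) (tensor_word i w)] at h
    rw [h]
    exact mul_mem (Algebra.subset_adjoin ⟨_, rfl⟩) ih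

theorem isClosed_discAlgebra (Λ : Type*) :
    IsClosed (discAlgebra Λ : Set (FockSpace Λ →L[ℂ] FockSpace Λ)) :=
  isClosed_closedAlgebra _

/-- L is continuous in u, and H^{⊗n} is the closed span of its words, whose creation operators are
products of those of letters. The closure is needed because Λ may be infinite. -/
theorem creation_mem_discAlgebra {n : ℕ} (u : tensorPower Λ n) : creation u ∈ discAlgebra Λ := by
  let K : Submodule ℂ (FockSpace Λ) :=
    (Subalgebra.toSubmodule (discAlgebra Λ)).comap
      ((creationCLM Λ n ∘L component n : FockSpace Λ →L[ℂ] _) : FockSpace Λ →ₗ[ℂ] _)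
  have hK : K = ⊤ := by
    refine eq_top_of_word_mem
      ((isClosed_discAlgebra Λ).preimage (creationCLM Λ n ∘L component n).continuous) fun w => ?_
    change creation (component n (word w)) ∈ discAlgebra Λ
    by_cases h : w.length = n
    · subst h
      have h1 := component_coe (⟨word w, word_mem_tensorPower w⟩ : tensorPower Λ w.length)
      simp only at h1
      rw [h1]
      exact adjoin_le_closedAlgebra _ (creation_word_mem_adjoin w)
    · have h1 := component_coe_of_ne h (⟨word w, word_mem_tensorPower w⟩ : tensorPower Λ w.length)
      simp only at h1
      rw [h1, creation_zero]
      exact zero_mem _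
  have h1 : (u : FockSpace Λ) ∈ K := hK ▸ Submodule.mem_top
  have h2 : creation (component n (u : FockSpace Λ)) ∈ discAlgebra Λ := h1
  rwa [component_coe] at h2

/-- The noncommutative polynomial `∑_{k < D} L(u_k)` with homogeneous components `u_k`. -/
def polynomial (D : ℕ) (u : ∀ k, tensorPower Λ k) : FockSpace Λ →L[ℂ] FockSpace Λ :=
  ∑ k ∈ Finset.range D, creation (u k)

theorem polynomial_mem_discAlgebra (D : ℕ) (u : ∀ k, tensorPower Λ k) :
    polynomial D u ∈ discAlgebra Λ :=
  sum_mem fun _ _ => creation_mem_discAlgebra _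

theorem polynomial_apply (D : ℕ) (u : ∀ k, tensorPower Λ k) (v : FockSpace Λ) (w : List Λ) :
    polynomial D u v w =
      ∑ k ∈ Finset.range D, (u k : FockSpace Λ) (w.take k) * v (w.drop k) := by
  rw [polynomial, _root_.sum_apply, ← coeff_apply, map_sum]
  rfl

theorem polynomial_rightShift (D : ℕ) (u : ∀ k, tensorPower Λ k) (i : Λ) (v : FockSpace Λ) :
    polynomial D u (rightShift i v) = rightShift i (polynomial D u v) := by
  simp only [polynomial, _root_.sum_apply, map_sum, creation_apply, tensor_rightShift]

theorem polynomial_eq_of_le {D D' : ℕ} (h : D ≤ D') {u : ∀ k, tensorPower Λ k}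
    (hu : ∀ k, D ≤ k → u k = 0) : polynomial D u = polynomial D' u := by
  refine Finset.sum_subset (Finset.range_mono h) fun k _ hk => ?_
  rw [hu k (by simpa using hk), creation_zero]

/-- Since L(u)L(v) = L(u ⊗ v), the span of all creation operators is already an algebra. -/
theorem exists_eq_polynomial {f : FockSpace Λ →L[ℂ] FockSpace Λ}
    (hf : f ∈ Algebra.adjoin ℂ (Set.range fun x : tensorPower Λ 1 => creation x)) :
    ∃ (D : ℕ) (u : ∀ k, tensorPower Λ k), (∀ k, D ≤ k → u k = 0) ∧ f = polynomial D u := by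
  have hspan : f ∈ Submodule.span ℂ
      {T : FockSpace Λ →L[ℂ] FockSpace Λ | ∃ (n : ℕ) (x : tensorPower Λ n), T = creation x} := by
    induction hf using Algebra.adjoin_induction with
    | mem f hf =>
      obtain ⟨x, rfl⟩ := hf
      exact Submodule.subset_span ⟨1, x, rfl⟩
    | algebraMap c =>
      rw [Algebra.algebraMap_eq_smul_one]
      refine Submodule.smul_mem _ _ (Submodule.subset_span
        ⟨0, ⟨word [], word_mem_tensorPower []⟩, ?_⟩)
      classical
      ext v w
      change v w = word [] _ * v w
      simp [word_apply]
    | add a b _ _ ha hb => exact add_mem ha hb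
    | mul a b _ _ ha hb =>
      have := Submodule.mul_mem_mul ha hb
      rw [Submodule.span_mul_span] at this
      refine Submodule.span_mono ?_ this
      rintro _ ⟨_, ⟨m, x, rfl⟩, _, ⟨n, y, rfl⟩, rfl⟩
      exact ⟨m + n, tmul x y, (creation_tmul x y).symm⟩
  clear hf
  induction hspan using Submodule.span_induction with
  | mem f hf =>
    obtain ⟨n, x, rfl⟩ := hf
    refine ⟨n + 1, Pi.single n x, fun k hk => Pi.single_eq_of_ne (by omega) _, ?_⟩
    rw [polynomial, Finset.sum_eq_single n]
    · rw [Pi.single_eq_same]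
    · intro k _ hk
      rw [Pi.single_eq_of_ne hk, creation_zero]
    · simp
  | zero => exact ⟨0, 0, fun _ _ => rfl, rfl⟩
  | add a b _ _ ha hb =>
    obtain ⟨D, u, hu, rfl⟩ := ha
    obtain ⟨D', u', hu', rfl⟩ := hb
    refine ⟨max D D', u + u', fun k hk => ?_, ?_⟩
    · rw [Pi.add_apply, hu k (by omega), hu' k (by omega), add_zero]
    · rw [polynomial_eq_of_le (le_max_left D D') hu, polynomial_eq_of_le (le_max_right D D') hu',
        polynomial, polynomial, polynomial, ← Finset.sum_add_distrib]
      exact Finset.sum_congr rfl fun k _ => (creation_add _ _).symm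
  | smul c a _ ha =>
    obtain ⟨D, u, hu, rfl⟩ := ha
    refine ⟨D, c • u, fun k hk => ?_, ?_⟩
    · rw [Pi.smul_apply, hu k hk, smul_zero]
    · rw [polynomial, polynomial, Finset.smul_sum]
      exact Finset.sum_congr rfl fun k _ => (creation_smul _ _).symm

theorem mapsTo_of_mem_discAlgebra {K : Submodule ℂ (FockSpace Λ)}
    (hK : IsClosed (K : Set (FockSpace Λ)))
    (h : ∀ x : tensorPower Λ 1, ∀ v ∈ K, creation x v ∈ K) {f : FockSpace Λ →L[ℂ] FockSpace Λ}
    (hf : f ∈ discAlgebra Λ) : ∀ v ∈ K, f v ∈ K := by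
  have key : ∀ g ∈ Algebra.adjoin ℂ (Set.range fun x : tensorPower Λ 1 => creation x),
      ∀ v ∈ K, g v ∈ K := by
    intro g hg
    induction hg using Algebra.adjoin_induction with
    | mem g hg =>
      obtain ⟨x, rfl⟩ := hg
      exact h x
    | algebraMap c =>
      intro v hv
      rw [Algebra.algebraMap_eq_smul_one]
      exact K.smul_mem c hv
    | add a b _ _ ha hb => exact fun v hv => add_mem (ha v hv) (hb v hv)
    | mul a b _ _ ha hb => exact fun v hv => ha _ (hb v hv)
  intro v hv
  exact closure_minimal (t := {g : FockSpace Λ →L[ℂ] FockSpace Λ | g v ∈ K}) (fun g hg => key g hg v hv)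
    (hK.preimage (ContinuousLinearMap.apply ℂ (FockSpace Λ) v).continuous) (mem_closure_adjoin hf)

end Polynomial

/-! ### Compression to the `X`-Fock space -/

namespace SubproductSystem

variable {Λ : Type*} (X : SubproductSystem Λ)

theorem mem_fock_orthogonal_iff {v : FockSpace Λ} :
    v ∈ X.fockᗮ ↔ ∀ k, component k v ∈ (X.fiber k)ᗮ := by
  rw [fock, Submodule.orthogonal_closure, ← Submodule.iInf_orthogonal, Submodule.mem_iInf]
  refine forall_congr' fun k => ?_
  rw [Submodule.mem_orthogonal', Submodule.mem_orthogonal']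
  constructor
  · intro h u hu
    rw [inner_component_left]
    exact h _ ⟨u, hu, rfl⟩
  · rintro h _ ⟨u, hu, rfl⟩
    rw [Submodule.subtype_apply, ← inner_component_left]
    exact h u hu

/-- For the converse, the residual of v after projection to 𝓕_X has components both in X_k and
orthogonal to X_k, so it vanishes. -/
theorem mem_fock_iff {v : FockSpace Λ} : v ∈ X.fock ↔ ∀ k, component k v ∈ X.fiber k := by
  have h1 : ∀ v ∈ X.fock, ∀ k, component k v ∈ X.fiber k := by
    intro v hv k
    have h : X.fock ≤ (X.fiber k).comap (component (Λ := Λ) k).toLinearMap := by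
      refine Submodule.topologicalClosure_minimal _ (iSup_le fun l => ?_)
        ((X.isClosed_fiber k).preimage (component k).continuous)
      rintro _ ⟨x, hx, rfl⟩
      change component k (x : FockSpace Λ) ∈ X.fiber k
      by_cases hl : l = k
      · subst hl
        rwa [component_coe]
      · rw [component_coe_of_ne hl]
        exact zero_mem _
    exact h hv
  refine ⟨h1 v, fun h => ?_⟩
  rw [← Submodule.starProjection_eq_self_iff, eq_comm, ← sub_eq_zero]
  ext w
  have hr := Submodule.sub_starProjection_mem_orthogonal (K := X.fock) v
  set r := v - X.fock.starProjection v with hrdef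
  have hc : component w.length r ∈ X.fiber w.length := by
    rw [hrdef, map_sub]
    exact sub_mem (h _) (h1 _ (Submodule.starProjection_apply_mem _ _) _)
  have h0 : component w.length r = 0 :=
    inner_self_eq_zero (𝕜 := ℂ).1 ((Submodule.mem_orthogonal _ _).1
      (X.mem_fock_orthogonal_iff.1 hr _) _ hc)
  rw [← component_apply_length, h0]; rfl

/-- Degreewise, H^{⊗m} ⊗ X_k^⊥ is orthogonal to X_m ⊗ X_k, hence to X_{m+k}. -/
theorem creation_mem_fock_orthogonal {m : ℕ} (u : tensorPower Λ m) {v : FockSpace Λ}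
    (hv : v ∈ X.fockᗮ) : creation u v ∈ X.fockᗮ := by
  rw [mem_fock_orthogonal_iff] at hv ⊢
  intro k
  rw [creation_apply]
  rcases lt_or_ge k m with h | h
  · rw [component_tensor_of_lt h]
    exact zero_mem _
  · obtain ⟨k, rfl⟩ := Nat.exists_eq_add_of_le h
    rw [component_tensor_add]
    exact X.tmul_mem_orthogonal_left u (hv k)

theorem creation_mem_fock_orthogonal_of_mem {m : ℕ} {u : tensorPower Λ m}
    (hu : u ∈ (X.fiber m)ᗮ) (v : FockSpace Λ) : creation u v ∈ X.fockᗮ := by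
  rw [mem_fock_orthogonal_iff]
  intro k
  rw [creation_apply]
  rcases lt_or_ge k m with h | h
  · rw [component_tensor_of_lt h]
    exact zero_mem _
  · obtain ⟨k, rfl⟩ := Nat.exists_eq_add_of_le h
    rw [component_tensor_add]
    exact X.tmul_mem_orthogonal_right hu _

theorem discAlgebra_apply_mem_fock_orthogonal {f : FockSpace Λ →L[ℂ] FockSpace Λ}
    (hf : f ∈ discAlgebra Λ) {v : FockSpace Λ} (hv : v ∈ X.fockᗮ) : f v ∈ X.fockᗮ :=
  mapsTo_of_mem_discAlgebra (Submodule.isClosed_orthogonal _)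
    (fun x _ => X.creation_mem_fock_orthogonal x) hf v hv

theorem coe_compression_apply (T : FockSpace Λ →L[ℂ] FockSpace Λ) (v : X.fock) :
    (X.compression T v : FockSpace Λ) = X.fock.starProjection (T v) := rfl

/-- 𝓕_X is co-invariant for f: replacing g v by its projection changes f (g v) only inside 𝓕_X^⊥. -/
theorem compression_mul {f : FockSpace Λ →L[ℂ] FockSpace Λ} (hf : f ∈ discAlgebra Λ)
    (g : FockSpace Λ →L[ℂ] FockSpace Λ) :
    X.compression (f * g) = X.compression f * X.compression g := by
  ext1 v
  refine Subtype.ext ?_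
  change X.fock.starProjection (f (g v)) =
    X.fock.starProjection (f (X.fock.starProjection (g v)))
  rw [← sub_eq_zero, ← map_sub, ← map_sub, Submodule.starProjection_apply_eq_zero_iff]
  exact X.discAlgebra_apply_mem_fock_orthogonal hf
    (Submodule.sub_starProjection_mem_orthogonal _)

theorem norm_compression_le (T : FockSpace Λ →L[ℂ] FockSpace Λ) : ‖X.compression T‖ ≤ ‖T‖ :=
  ContinuousLinearMap.opNorm_le_bound _ (norm_nonneg T) fun v =>
    (X.fock.norm_starProjection_apply_le _).trans (T.le_opNorm v)

/-- The compression as a continuous linear map. -/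
def compressionCLM : (FockSpace Λ →L[ℂ] FockSpace Λ) →L[ℂ] X.fock →L[ℂ] X.fock :=
  LinearMap.mkContinuous
    { toFun := X.compression
      map_add' := fun S T => by
        ext1 v
        simp [compression]
      map_smul' := fun c T => by
        ext1 v
        simp [compression] }
    1 fun T => (X.norm_compression_le T).trans_eq (one_mul _).symm

theorem compressionCLM_apply (T : FockSpace Λ →L[ℂ] FockSpace Λ) :
    X.compressionCLM T = X.compression T := rfl

theorem compression_one : X.compression 1 = 1 := by
  ext1 v
  refine Subtype.ext ?_
  rw [coe_compression_apply]
  exact Submodule.starProjection_eq_self_iff.2 v.2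

theorem compression_eq_zero_of_mem {f : FockSpace Λ →L[ℂ] FockSpace Λ}
    (hf : f ∈ X.idealClosure) : X.compression f = 0 := by
  have h : X.idealClosure ≤
      LinearMap.ker X.compressionCLM.toLinearMap := by
    refine Submodule.topologicalClosure_minimal _ (Submodule.span_le.2 ?_)
      X.compressionCLM.isClosed_ker
    rintro _ ⟨n, x, hx, rfl⟩
    change X.compression (creation x) = 0
    ext1 v
    refine Subtype.ext ?_
    rw [coe_compression_apply]
    exact (Submodule.starProjection_apply_eq_zero_iff _).2
      (X.creation_mem_fock_orthogonal_of_mem hx _)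
  exact h hf

theorem compression_mem_tensorAlgebra {f : FockSpace Λ →L[ℂ] FockSpace Λ}
    (hf : f ∈ discAlgebra Λ) : X.compression f ∈ X.tensorAlgebra := by
  have key : ∀ g ∈ Algebra.adjoin ℂ (Set.range fun x : tensorPower Λ 1 => creation x),
      X.compression g ∈ X.tensorAlgebra := by
    intro g hg
    induction hg using Algebra.adjoin_induction with
    | mem g hg =>
      obtain ⟨x, rfl⟩ := hg
      have hx : x ∈ X.fiber 1 := X.fiber_one ▸ Submodule.mem_top
      exact adjoin_le_closedAlgebra _ (Algebra.subset_adjoin ⟨⟨x, hx⟩, rfl⟩)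
    | algebraMap c =>
      rw [Algebra.algebraMap_eq_smul_one, ← compressionCLM_apply, map_smul, compressionCLM_apply,
        compression_one]
      exact Subalgebra.smul_mem _ (one_mem _) c
    | add a b _ _ ha hb =>
      rw [← compressionCLM_apply, map_add]
      exact add_mem ha hb
    | mul a b ha' _ ha hb =>
      rw [X.compression_mul (adjoin_le_closedAlgebra _ ha')]
      exact mul_mem ha hb
  exact closure_minimal (t := X.compression ⁻¹' (X.tensorAlgebra : Set (X.fock →L[ℂ] X.fock))) key
    ((isClosed_closedAlgebra _).preimage X.compressionCLM.continuous) (mem_closure_adjoin hf)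

end SubproductSystem

/-! ### Cesàro means of truncated noncommutative Toeplitz matrices -/

/-- With U the row isometry assembled from the V i, the hypotheses say A = U (⨁ A') U*. -/
theorem norm_le_of_intertwines {ι E : Type*} [NormedAddCommGroup E] [InnerProductSpace ℂ E]
    [CompleteSpace E] {V : ι → E →ₗᵢ[ℂ] E} (hV : OrthogonalFamily ℂ (fun _ : ι => E) V)
    {A A' : E →L[ℂ] E} (h : ∀ i x, A (V i x) = V i (A' x))
    (h0 : ∀ y, (∀ i x, ⟪V i x, y⟫_ℂ = 0) → A y = 0) : ‖A‖ ≤ ‖A'‖ := by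
  classical
  set U := hV.linearIsometry.toContinuousLinearMap with hU
  have hUs : ∀ i x, U (lp.single 2 i x) = V i x := fun i x => hV.linearIsometry_apply_single x
  have hUn : ∀ z, ‖U z‖ = ‖z‖ := fun z => hV.linearIsometry.norm_map z
  have hUU : ∀ z, U.adjoint (U z) = z := by
    intro z
    refine ext_inner_right ℂ fun w => ?_
    rw [ContinuousLinearMap.adjoint_inner_left]
    exact hV.linearIsometry.inner_map_map z w
  have hUa : ‖U.adjoint‖ ≤ 1 := by
    rw [LinearIsometryEquiv.norm_map]
    exact hV.linearIsometry.norm_toContinuousLinearMap_le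
  have hAU : A ∘L U = U ∘L ampliation ι A' := by
    refine lp.ext_continuousLinearMap (by norm_num) fun i => ?_
    ext x
    simp only [ContinuousLinearMap.comp_apply, lp.singleContinuousLinearMap_apply,
      ampliation_single, hUs, h]
  refine A.opNorm_le_bound (norm_nonneg _) fun x => ?_
  have h1 : A (x - U (U.adjoint x)) = 0 := h0 _ fun i v => by
    rw [← hUs, ← ContinuousLinearMap.adjoint_inner_right, map_sub, hUU, sub_self, inner_zero_right]
  rw [map_sub, sub_eq_zero] at h1
  have h2 : A (U (U.adjoint x)) = U (ampliation ι A' (U.adjoint x)) := DFunLike.congr_fun hAU _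
  rw [h1, h2, hUn]
  refine (ContinuousLinearMap.le_of_opNorm_le _ (norm_ampliation_le A') _).trans ?_
  gcongr
  simpa using ContinuousLinearMap.le_of_opNorm_le _ hUa x

/-! ### Coordinates and degree projections on direct sums of Fock spaces -/

variable {Λ : Type*} {n : ℕ}

theorem PiLp_fock_ext {u v : PiLp 2 fun _ : Fin n => FockSpace Λ} (h : ∀ a w, u a w = v a w) :
    u = v := by
  ext a w
  exact h a w

theorem PiLp_inner_single_left {E : Type*} [NormedAddCommGroup E] [InnerProductSpace ℂ E]
    (a : Fin n) (u : E) (z : PiLp 2 fun _ : Fin n => E) :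
    ⟪PiLp.single 2 a u, z⟫_ℂ = ⟪u, z a⟫_ℂ := by
  rw [PiLp.inner_apply, Finset.sum_eq_single a]
  · rw [PiLp.single_eq_same]
  · intro b _ hb
    rw [PiLp.single_eq_of_ne 2 hb, inner_zero_left]
  · simp

theorem PiLp_fock_ext_continuousLinearMap {F : Type*} [NormedAddCommGroup F] [NormedSpace ℂ F]
    {f g : (PiLp 2 fun _ : Fin n => FockSpace Λ) →L[ℂ] F}
    (h : ∀ b w, f (PiLp.single 2 b (word w)) = g (PiLp.single 2 b (word w))) : f = g := by
  let s : Fin n → FockSpace Λ →L[ℂ] PiLp 2 fun _ : Fin n => FockSpace Λ := fun b =>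
    (PiLp.continuousLinearEquiv 2 ℂ (fun _ : Fin n => FockSpace Λ)).symm.toContinuousLinearMap ∘L
      ContinuousLinearMap.single ℂ (fun _ : Fin n => FockSpace Λ) b
  have hs : ∀ b v, s b v = PiLp.single 2 b v := fun b v => rfl
  have h1 : ∀ b, f ∘L s b = g ∘L s b := fun b =>
    FockSpace.ext_continuousLinearMap fun w => h b w
  ext1 x
  have hx : x = ∑ b, s b (x b) := by
    ext1 a
    rw [WithLp.ofLp_sum, Finset.sum_apply, Finset.sum_eq_single a]
    · rw [hs, PiLp.single_eq_same]
    · intro b _ hb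
      rw [hs, PiLp.single_eq_of_ne' 2 hb]
    · simp
  rw [hx, map_sum, map_sum]
  exact Finset.sum_congr rfl fun b _ => DFunLike.congr_fun (h1 b) (x b)

/-- The projection onto the span of the words with length in `s`, on `n` copies. -/
def degProj (n : ℕ) (s : Set ℕ) [DecidablePred (· ∈ s)] :
    (PiLp 2 fun _ : Fin n => FockSpace Λ) →L[ℂ] PiLp 2 fun _ : Fin n => FockSpace Λ :=
  diagOperator n (degreeProj s)

theorem degProj_apply (s : Set ℕ) [DecidablePred (· ∈ s)]
    (x : PiLp 2 fun _ : Fin n => FockSpace Λ) (a : Fin n) (w : List Λ) :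
    degProj n s x a w = if w.length ∈ s then x a w else 0 :=
  degreeProj_apply s (x a) w

theorem norm_degProj_le (s : Set ℕ) [DecidablePred (· ∈ s)]
    (x : PiLp 2 fun _ : Fin n => FockSpace Λ) : ‖degProj n s x‖ ≤ ‖x‖ :=
  norm_diagOperator_apply_le (norm_degreeProj_le s) x

theorem degProj_of_subset {s t : Set ℕ} [DecidablePred (· ∈ s)] [DecidablePred (· ∈ t)]
    (h : s ⊆ t) (x : PiLp 2 fun _ : Fin n => FockSpace Λ) :
    degProj n s (degProj n t x) = degProj n s x := by
  refine PiLp_fock_ext fun a w => ?_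
  simp only [degProj_apply]
  split_ifs with h1 h2
  · rfl
  · exact absurd (h h1) h2
  · rfl

theorem degProj_idem (s : Set ℕ) [DecidablePred (· ∈ s)]
    (x : PiLp 2 fun _ : Fin n => FockSpace Λ) :
    degProj n s (degProj n s x) = degProj n s x := degProj_of_subset subset_rfl x

theorem inner_degProj_right (s : Set ℕ) [DecidablePred (· ∈ s)]
    (x y : PiLp 2 fun _ : Fin n => FockSpace Λ) :
    ⟪x, degProj n s y⟫_ℂ = ⟪degProj n s x, y⟫_ℂ := by
  rw [PiLp.inner_apply, PiLp.inner_apply]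
  refine Finset.sum_congr rfl fun a _ => ?_
  rw [inner_eq_tsum, inner_eq_tsum]
  refine tsum_congr fun w => ?_
  rw [degProj_apply, degProj_apply]
  split_ifs <;> simp

theorem hasSum_norm_sq (x : PiLp 2 fun _ : Fin n => FockSpace Λ) :
    HasSum (fun w => ∑ a, ‖x a w‖ ^ 2) (‖x‖ ^ 2) := by
  rw [PiLp.norm_sq_eq_of_L2]
  refine hasSum_sum fun a _ => ?_
  rw [norm_sq_eq_tsum]
  exact (x a).summable_sq.hasSum

theorem norm_le_of_forall_degProj_le {x : PiLp 2 fun _ : Fin n => FockSpace Λ} {C : ℝ}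
    (hC : 0 ≤ C) (h : ∀ M, ‖degProj n (Set.Iic M) x‖ ≤ C) : ‖x‖ ≤ C := by
  refine (sq_le_sq₀ (norm_nonneg _) hC).1 ?_
  refine hasSum_le_of_sum_le (hasSum_norm_sq x) fun s => ?_
  have h1 : ∑ w ∈ s, ∑ a, ‖x a w‖ ^ 2 ≤ ‖degProj n (Set.Iic (s.sup List.length)) x‖ ^ 2 := by
    refine le_trans (Finset.sum_le_sum fun w hw => ?_)
      (sum_le_hasSum s (fun w _ => by positivity) (hasSum_norm_sq _))
    refine Finset.sum_le_sum fun a _ => ?_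
    rw [degProj_apply, if_pos (Set.mem_Iic.2 (Finset.le_sup (f := List.length) hw))]
  exact h1.trans (pow_le_pow_left₀ (norm_nonneg _) (h _) 2)

/-- The degrees `d` with `d ≤ j ≤ d + N`. -/
def window (N j : ℕ) : Set ℕ := {d | d ≤ j ∧ j ≤ d + N}

theorem mem_window {N j d : ℕ} : d ∈ window N j ↔ d ≤ j ∧ j ≤ d + N := Iff.rfl

instance (N j : ℕ) : DecidablePred (· ∈ window N j) := fun d =>
  inferInstanceAs (Decidable (d ≤ j ∧ j ≤ d + N))

/-- A word of length d lies in the windows with d ≤ j ≤ d + N, which are N + 1 in number. -/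
theorem sum_norm_degProj_window_sq_le (N : ℕ) (s : Finset ℕ)
    (x : PiLp 2 fun _ : Fin n => FockSpace Λ) :
    ∑ j ∈ s, ‖degProj n (window N j) x‖ ^ 2 ≤ (N + 1) * ‖x‖ ^ 2 := by
  refine hasSum_le (fun w => ?_) (hasSum_sum fun j _ => hasSum_norm_sq (degProj n (window N j) x))
    ((hasSum_norm_sq x).mul_left ((N : ℝ) + 1))
  rw [Finset.sum_comm, Finset.mul_sum]
  refine Finset.sum_le_sum fun a _ => ?_
  have h1 : ∀ j, ‖degProj n (window N j) x a w‖ ^ 2 =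
      if w.length ∈ window N j then ‖x a w‖ ^ 2 else 0 := fun j => by
    rw [degProj_apply]
    split_ifs <;> simp
  simp only [h1]
  rw [← Finset.sum_filter, Finset.sum_const, nsmul_eq_mul]
  gcongr
  have h2 : s.filter (fun j => w.length ∈ window N j) ⊆ Finset.Icc w.length (w.length + N) :=
    fun j hj => Finset.mem_Icc.2 (Finset.mem_filter.1 hj).2
  have h3 := Finset.card_le_card h2
  rw [Nat.card_Icc] at h3
  have h4 : (s.filter (fun j => w.length ∈ window N j)).card ≤ N + 1 := by omega
  exact_mod_cast h4

theorem degProj_window_rightShift (N j : ℕ) (i : Λ)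
    (x : PiLp 2 fun _ : Fin n => FockSpace Λ) :
    degProj n (window N (j + 1)) (diagIsometry n (rightShift i) x) =
      diagIsometry n (rightShift i) (degProj n (window N j) x) := by
  refine PiLp_fock_ext fun a w => ?_
  rw [degProj_apply, diagIsometry_apply, diagIsometry_apply]
  induction w using List.reverseRecOn with
  | nil => simp
  | append_singleton w k _ =>
    by_cases h : i = k
    · subst h
      have : (w ++ [i]).length ∈ window N (j + 1) ↔ w.length ∈ window N j := by
        simp [mem_window]; omega
      rw [rightShift_append_self, rightShift_append_self, degProj_apply]
      simp only [this]
    · simp [rightShift_append_ne h]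

/-- For j ≥ N the window ending at j + 1 omits degree 0, so each of its words ends in a letter and
lies in the range of a right shift. -/
theorem degProj_window_eq_zero (N j : ℕ) (hj : N ≤ j)
    {x : PiLp 2 fun _ : Fin n => FockSpace Λ}
    (hx : ∀ (i : Λ) y, ⟪diagIsometry n (rightShift i) y, x⟫_ℂ = 0) :
    degProj n (window N (j + 1)) x = 0 := by
  refine PiLp_fock_ext fun a w => ?_
  rw [degProj_apply]
  induction w using List.reverseRecOn with
  | nil => rw [if_neg (by simp [mem_window]; omega)]; rfl
  | append_singleton w i _ =>
    have h1 := hx i (PiLp.single 2 a (word w))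
    have h2 : diagIsometry n (rightShift i) (PiLp.single 2 a (word w)) =
        PiLp.single 2 a (word (w ++ [i])) := by
      ext1 b
      by_cases hb : b = a
      · subst hb
        simp [rightShift_word]
      · simp [hb]
    rw [h2, PiLp_inner_single_left, inner_word] at h1
    rw [h1, ite_self]; rfl

/-! ### Averaging the window compressions -/

section Cesaro

variable {N : ℕ} {t : Fin n → Fin n → ∀ k, tensorPower Λ k} {c : ℝ}

/-- For j ≤ N the window lies in degrees up to N, where the hypothesis applies. Beyond that,
commutation with right shifts makes the compression to window j + 1 an amplification of the one to
window j. -/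
theorem norm_window_compression_le (hc : 0 ≤ c)
    (h : ∀ x, ‖degProj n (Set.Iic N)
      (matrixOperator (Matrix.of fun a b => polynomial (N + 1) (t a b)) x)‖ ≤ c * ‖x‖) (j : ℕ) :
    ‖degProj n (window N j) ∘L
      matrixOperator (Matrix.of fun a b => polynomial (N + 1) (t a b)) ∘L
        degProj n (window N j)‖ ≤ c := by
  set T := matrixOperator (Matrix.of fun a b => polynomial (N + 1) (t a b)) with hT
  rcases le_total j N with hj | hj
  · refine ContinuousLinearMap.opNorm_le_bound _ hc fun x => ?_
    have hsub : window N j ⊆ Set.Iic N := fun d hd => Set.mem_Iic.2 (hd.1.trans hj)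
    rw [ContinuousLinearMap.comp_apply, ContinuousLinearMap.comp_apply, ← degProj_of_subset hsub]
    refine (norm_degProj_le _ _).trans ((h _).trans ?_)
    gcongr
    exact norm_degProj_le _ _
  · induction j, hj using Nat.le_induction with
    | base =>
      refine ContinuousLinearMap.opNorm_le_bound _ hc fun x => ?_
      have hsub : window N N ⊆ Set.Iic N := fun d hd => Set.mem_Iic.2 hd.1
      rw [ContinuousLinearMap.comp_apply, ContinuousLinearMap.comp_apply, ← degProj_of_subset hsub]
      refine (norm_degProj_le _ _).trans ((h _).trans ?_)
      gcongr
      exact norm_degProj_le _ _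
    | succ j hj ih =>
      refine le_trans (norm_le_of_intertwines (orthogonalFamily_rightShift Λ n)
        (fun i x => ?_) fun y hy => ?_) ih
      · simp only [ContinuousLinearMap.comp_apply]
        rw [degProj_window_rightShift N j, hT, matrixOperator_diagIsometry,
          degProj_window_rightShift N j]
        intro a b v
        exact polynomial_rightShift _ _ _ _
      · simp only [ContinuousLinearMap.comp_apply]
        rw [degProj_window_eq_zero N j hj hy, map_zero, map_zero]

/-- The L(t_k) part, which raises degree by k, survives in a window exactly when both degrees lie in
it, and this happens for N + 1 - k windows. Windows meeting degrees up to M have j ≤ M + N, so the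
finite sum is complete there. -/
theorem sum_window_compression_apply (t : Fin n → Fin n → ∀ k, tensorPower Λ k)
    (x : PiLp 2 fun _ : Fin n => FockSpace Λ) {M : ℕ} (a : Fin n) {w : List Λ}
    (hw : w.length ≤ M) :
    ∑ j ∈ Finset.range (M + N + 1), degProj n (window N j)
        (matrixOperator (Matrix.of fun a b => polynomial (N + 1) (t a b))
          (degProj n (window N j) x)) a w =
      ((N : ℂ) + 1) * matrixOperator (Matrix.of fun a b =>
        polynomial (N + 1) fun k => (1 - (k : ℂ) / (N + 1)) • t a b k) x a w := by
  have hcoeff : ∀ (s : Fin n → Fin n → ∀ k, tensorPower Λ k)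
      (y : PiLp 2 fun _ : Fin n => FockSpace Λ),
      matrixOperator (Matrix.of fun a b => polynomial (N + 1) (s a b)) y a w =
        ∑ b, ∑ k ∈ Finset.range (N + 1), (s a b k : FockSpace Λ) (w.take k) * y b (w.drop k) := by
    intro s y
    rw [matrixOperator_apply, ← coeff_apply, map_sum]
    refine Finset.sum_congr rfl fun b _ => ?_
    rw [Matrix.of_apply, coeff_apply, polynomial_apply]
  rw [hcoeff, Finset.mul_sum]
  simp only [degProj_apply, hcoeff]
  have hmove : ∀ j, (if w.length ∈ window N j then
      ∑ b, ∑ k ∈ Finset.range (N + 1), (t a b k : FockSpace Λ) (w.take k) *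
        (if (w.drop k).length ∈ window N j then x b (w.drop k) else 0) else 0) =
      ∑ b, ∑ k ∈ Finset.range (N + 1), if w.length ∈ window N j ∧ (w.drop k).length ∈ window N j
        then (t a b k : FockSpace Λ) (w.take k) * x b (w.drop k) else 0 := by
    intro j
    by_cases hj : w.length ∈ window N j
    · simp [hj]
    · simp [hj]
  simp only [hmove]
  rw [Finset.sum_comm]
  refine Finset.sum_congr rfl fun b _ => ?_
  rw [Finset.sum_comm, Finset.mul_sum]
  refine Finset.sum_congr rfl fun k hk => ?_
  rw [Finset.mem_range] at hk
  rw [← Finset.sum_filter, Finset.sum_const, nsmul_eq_mul]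
  change _ = ((N : ℂ) + 1) * (((1 - (k : ℂ) / (N + 1)) * (t a b k : FockSpace Λ) (w.take k)) *
    x b (w.drop k))
  rcases le_or_gt k w.length with hkw | hkw
  · have h1 : (Finset.range (M + N + 1)).filter
        (fun j => w.length ∈ window N j ∧ (w.drop k).length ∈ window N j) =
        Finset.Icc w.length (w.length - k + N) := by
      ext j
      simp only [Finset.mem_filter, Finset.mem_range, Finset.mem_Icc, mem_window, List.length_drop]
      omega
    rw [h1, Nat.card_Icc, show w.length - k + N + 1 - w.length = N + 1 - k by omega,
      Nat.cast_sub hk.le]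
    have : (N : ℂ) + 1 ≠ 0 := by exact_mod_cast Nat.succ_ne_zero N
    push_cast
    field_simp
  -- For k > |w| the count of windows is irrelevant: the coefficient of t_k at a word shorter than k
  -- is 0.
  · rw [(t a b k).2 (w.take k) (by simp; omega)]
    simp

/-- N + 1 times the mean is a sum of operators P_j T P_j of norm at most c. Cauchy–Schwarz in j
applies because each degree is covered N + 1 times, both for x and for y; the factor N + 1 then
cancels. -/
theorem norm_cesaro_le (hc : 0 ≤ c)
    (h : ∀ x, ‖degProj n (Set.Iic N)
      (matrixOperator (Matrix.of fun a b => polynomial (N + 1) (t a b)) x)‖ ≤ c * ‖x‖) :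
    ‖matrixOperator (Matrix.of fun a b =>
      polynomial (N + 1) fun k => (1 - (k : ℂ) / (N + 1)) • t a b k)‖ ≤ c := by
  set T := matrixOperator (Matrix.of fun a b => polynomial (N + 1) (t a b)) with hT
  set S := matrixOperator (Matrix.of fun a b =>
    polynomial (N + 1) fun k => (1 - (k : ℂ) / (N + 1)) • t a b k) with hS
  -- Cutting the output to degrees up to M makes the sum over windows finite; the bound does not
  -- depend on M.
  refine S.opNorm_le_bound hc fun x => norm_le_of_forall_degProj_le (by positivity) fun M => ?_
  set y := degProj n (Set.Iic M) (S x) with hy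
  set A := fun j => degProj n (window N j) (T (degProj n (window N j) x)) with hA
  have hsum : degProj n (Set.Iic M) (∑ j ∈ Finset.range (M + N + 1), A j) =
      ((N : ℂ) + 1) • y := by
    refine PiLp_fock_ext fun a w => ?_
    rw [hy, PiLp.smul_apply, smul_apply, degProj_apply, degProj_apply]
    split_ifs with hw
    · rw [← sum_window_compression_apply t x a hw, WithLp.ofLp_sum, Finset.sum_apply,
        ← coeff_apply, map_sum]
      rfl
    · rw [mul_zero]
  have hAn : ∀ j, ‖A j‖ ≤ c * ‖degProj n (window N j) x‖ := fun j => by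
    have := ContinuousLinearMap.le_of_opNorm_le _ (norm_window_compression_le hc h j)
      (degProj n (window N j) x)
    rwa [ContinuousLinearMap.comp_apply, ContinuousLinearMap.comp_apply, degProj_idem] at this
  have hinner : ∀ j, (⟪y, A j⟫_ℂ).re ≤
      c * (‖degProj n (window N j) y‖ * ‖degProj n (window N j) x‖) := fun j => by
    have h1 : ⟪y, A j⟫_ℂ = ⟪degProj n (window N j) y, A j⟫_ℂ := by
      have h2 : degProj n (window N j) (A j) = A j := degProj_idem _ _
      rw [← inner_degProj_right (window N j) y (A j), h2]
    rw [h1]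
    refine (Complex.re_le_norm _).trans ((norm_inner_le_norm _ _).trans ?_)
    refine (mul_le_mul_of_nonneg_left (hAn j) (norm_nonneg _)).trans_eq (by ring)
  have hmain : ((N : ℝ) + 1) * ‖y‖ ^ 2 ≤ c * (((N : ℝ) + 1) * (‖y‖ * ‖x‖)) := by
    have h1 : (((N : ℝ) + 1) * ‖y‖ ^ 2) = (⟪y, ((N : ℂ) + 1) • y⟫_ℂ).re := by
      rw [inner_smul_right, inner_self_eq_norm_sq_to_K]
      have : ((N : ℂ) + 1) * ((‖y‖ : ℝ) : ℂ) ^ 2 = (((N : ℝ) + 1) * ‖y‖ ^ 2 : ℝ) := by push_cast; ring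
      exact ((congrArg Complex.re this).trans (Complex.ofReal_re _)).symm
    rw [h1, ← hsum, inner_degProj_right, hy, degProj_idem, ← hy, inner_sum, Complex.re_sum]
    refine (Finset.sum_le_sum fun j _ => hinner j).trans ?_
    rw [← Finset.mul_sum]
    refine mul_le_mul_of_nonneg_left ?_ hc
    refine le_of_sq_le_sq ?_ (by positivity)
    refine (Finset.sum_mul_sq_le_sq_mul_sq _ _ _).trans ?_
    refine (mul_le_mul (sum_norm_degProj_window_sq_le N _ y) (sum_norm_degProj_window_sq_le N _ x)
      (by positivity) (by positivity)).trans_eq (by ring)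
  rcases (norm_nonneg y).eq_or_lt with h0 | h0
  · rw [← h0]; positivity
  · have hN : (0 : ℝ) < (N : ℝ) + 1 := by positivity
    refine le_of_mul_le_mul_left ?_ (mul_pos hN h0)
    nlinarith

end Cesaro

namespace SubproductSystem

variable {Λ : Type*} (X : SubproductSystem Λ)

/-! ### Lifting polynomials -/

/-- The component of degree `k` of the adjoint of the right shift. -/
def annihilation (k : ℕ) (i : Λ) : FockSpace Λ →L[ℂ] tensorPower Λ k :=
  component k ∘L (rightShift i).toContinuousLinearMap.adjoint

theorem annihilation_apply (k : ℕ) (i : Λ) (v : FockSpace Λ) (w : List Λ) :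
    (annihilation k i v : FockSpace Λ) w = if w.length = k then v (w ++ [i]) else 0 := by
  have h : annihilation k i v =
    component k ((rightShift i).toContinuousLinearMap.adjoint v) := rfl
  rw [h, component_apply, adjoint_rightShift_apply]

theorem annihilation_component (k : ℕ) (i : Λ) (v : FockSpace Λ) :
    annihilation k i (component (k + 1) v : FockSpace Λ) = annihilation k i v := by
  ext w
  rw [annihilation_apply, annihilation_apply, component_apply]
  split_ifs with h2 h3
  · rfl
  · exact absurd (by simp [h2]) h3
  · rfl

theorem annihilation_tmul {k : ℕ} (i : Λ) (u : tensorPower Λ k) (v : tensorPower Λ 1) :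
    annihilation k i (tmul u v : FockSpace Λ) = (v : FockSpace Λ) [i] • u := by
  ext w
  have h : ((tmul u v : tensorPower Λ (k + 1)) : FockSpace Λ) = tensor u v := rfl
  rw [annihilation_apply, h, tensor_apply, Submodule.coe_smul, FockSpace.smul_apply]
  split_ifs with hw
  · rw [List.take_left' hw, List.drop_left' hw, mul_comm]
  · rw [u.2 w hw, mul_zero]

/-- Uses X_{k+1} ⊆ X_k ⊗ X_1 with the single factor on the right: pairing the last letter with a
basis vector leaves an element of X_k. -/
theorem annihilation_mem {k : ℕ} (i : Λ) {x : tensorPower Λ (k + 1)} (hx : x ∈ X.fiber (k + 1)) :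
    annihilation k i (x : FockSpace Λ) ∈ X.fiber k := by
  set R := annihilation k i ∘L (tensorPower Λ (k + 1)).subtypeL with hR
  have h2 : X.fiber (k + 1) ≤ (X.fiber k).comap R.toLinearMap := by
    refine (X.fiber_add_le k 1).trans (Submodule.topologicalClosure_minimal _
      (Submodule.span_le.2 ?_) ((X.isClosed_fiber k).preimage R.continuous))
    rintro _ ⟨u, hu, v, -, rfl⟩
    change annihilation k i (tmul u v : FockSpace Λ) ∈ X.fiber k
    rw [annihilation_tmul]
    exact Submodule.smul_mem _ _ hu
  exact h2 hx

/-- The families of vectors of the full Fock space whose components of degree `> N` are in `X`. -/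
def truncation (n N : ℕ) : Submodule ℂ (PiLp 2 fun _ : Fin n => FockSpace Λ) where
  carrier := {x | ∀ a k, N < k → component k (x a) ∈ X.fiber k}
  zero_mem' := fun a k _ => by simp
  add_mem' := fun hx hy a k hk => by
    rw [PiLp.add_apply, map_add]
    exact add_mem (hx a k hk) (hy a k hk)
  smul_mem' := fun c x hx a k hk => by
    rw [PiLp.smul_apply, map_smul]
    exact Submodule.smul_mem _ _ (hx a k hk)

variable {n : ℕ}

theorem mem_truncation {N : ℕ} {x : PiLp 2 fun _ : Fin n => FockSpace Λ} :
    x ∈ X.truncation n N ↔ ∀ a k, N < k → component k (x a) ∈ X.fiber k := Iff.rfl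

theorem isClosed_truncation (n N : ℕ) :
    IsClosed (X.truncation n N : Set (PiLp 2 fun _ : Fin n => FockSpace Λ)) := by
  have h : (X.truncation n N : Set (PiLp 2 fun _ : Fin n => FockSpace Λ)) =
      ⋂ (a : Fin n) (k : ℕ) (_ : N < k), (fun x : PiLp 2 fun _ : Fin n => FockSpace Λ =>
        component k (x a)) ⁻¹' (X.fiber k) := by
    ext x
    simp only [SetLike.mem_coe, mem_truncation, Set.mem_iInter, Set.mem_preimage]
  rw [h]
  exact isClosed_iInter fun a => isClosed_iInter fun k => isClosed_iInter fun _ =>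
    (X.isClosed_fiber k).preimage ((component k).continuous.comp (PiLp.continuous_apply 2 _ a))

instance (n N : ℕ) : CompleteSpace (X.truncation n N) :=
  (X.isClosed_truncation n N).completeSpace_coe

/-- Degree 0 imposes no condition on either side because X_0 is everything. -/
theorem mem_truncation_zero {x : PiLp 2 fun _ : Fin n => FockSpace Λ} :
    x ∈ X.truncation n 0 ↔ ∀ a, x a ∈ X.fock := by
  simp only [mem_truncation, mem_fock_iff]
  refine forall_congr' fun a => ⟨fun h k => ?_, fun h k _ => h k⟩
  rcases k.eq_zero_or_pos with rfl | hk
  · rw [X.fiber_zero]; exact Submodule.mem_top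
  · exact h k hk

theorem truncation_le (n N : ℕ) : X.truncation n N ≤ X.truncation n (N + 1) :=
  fun _ hx a k hk => hx a k (by omega)

theorem adjoint_rightShift_mem_truncation {M N : ℕ} (h : M ≤ N + 1) (i : Λ)
    {x : PiLp 2 fun _ : Fin n => FockSpace Λ} (hx : x ∈ X.truncation n M) :
    (diagIsometry n (rightShift i)).toContinuousLinearMap.adjoint x ∈ X.truncation n N := by
  intro a k hk
  rw [adjoint_diagIsometry_apply]
  have h1 := X.annihilation_mem i (hx a (k + 1) (by omega))
  rwa [annihilation_component] at h1

/-- Words of length at most N belong to the truncation, so projecting preserves their coefficients.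
-/
theorem starProjection_truncation_apply {N : ℕ} (z : PiLp 2 fun _ : Fin n => FockSpace Λ)
    (a : Fin n) {w : List Λ} (hw : w.length ≤ N) :
    (X.truncation n N).starProjection z a w = z a w := by
  have h1 : PiLp.single 2 a (word w) ∈ X.truncation n N := by
    intro b k hk
    have h2 : component k (word w) = 0 :=
      component_coe_of_ne (by omega) (⟨word w, word_mem_tensorPower w⟩ : tensorPower Λ w.length)
    by_cases hb : b = a
    · subst hb
      rw [PiLp.single_eq_same, h2]
      exact zero_mem _
    · rw [PiLp.single_eq_of_ne 2 hb, map_zero]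
      exact zero_mem _
  have h2 := (Submodule.mem_orthogonal _ _).1
    (Submodule.sub_starProjection_mem_orthogonal (K := X.truncation n N) z) _ h1
  rw [PiLp_inner_single_left, inner_word, PiLp.sub_apply, FockSpace.sub_apply, sub_eq_zero] at h2
  exact h2.symm

theorem starProjection_truncation_zero_apply (z : PiLp 2 fun _ : Fin n => FockSpace Λ) (a : Fin n) :
    (X.truncation n 0).starProjection z a = X.fock.starProjection (z a) := by
  have h : diagOperator n X.fock.starProjection z = (X.truncation n 0).starProjection z := by
    refine (Submodule.eq_starProjection_of_mem_orthogonal ?_ ?_).symm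
    · rw [mem_truncation_zero]
      exact fun a => Submodule.starProjection_apply_mem _ _
    · rw [Submodule.mem_orthogonal]
      intro y hy
      rw [mem_truncation_zero] at hy
      rw [PiLp.inner_apply]
      exact Finset.sum_eq_zero fun a _ => (Submodule.mem_orthogonal _ _).1
        (Submodule.sub_starProjection_mem_orthogonal (K := X.fock) (z a)) _ (hy a)
  rw [← h, diagOperator_apply]

/-- By co-invariance PF = PFP, so restricting the source to 𝓕_X^n loses nothing. -/
theorem norm_starProjection_comp_matrixOperator_le
    {F : Matrix (Fin n) (Fin n) (FockSpace Λ →L[ℂ] FockSpace Λ)}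
    (hF : ∀ a b, F a b ∈ discAlgebra Λ) :
    ‖(X.truncation n 0).starProjection ∘L matrixOperator F‖ ≤
      ‖matrixOperator (F.map X.compression)‖ := by
  refine ContinuousLinearMap.opNorm_le_bound _
    (norm_nonneg (matrixOperator (F.map X.compression))) fun x => ?_
  have h1 : (X.truncation n 0).starProjection (matrixOperator F x) =
      diagOperator n X.fock.subtypeL (matrixOperator (F.map X.compression)
        (diagOperator n X.fock.orthogonalProjectionOnto x)) := by
    ext1 a
    rw [starProjection_truncation_zero_apply, diagOperator_apply, matrixOperator_apply,
      matrixOperator_apply, map_sum, map_sum]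
    refine Finset.sum_congr rfl fun b _ => ?_
    change _ = X.fock.starProjection (F a b (X.fock.starProjection (x b)))
    rw [← sub_eq_zero, ← map_sub, ← map_sub, Submodule.starProjection_apply_eq_zero_iff]
    exact X.discAlgebra_apply_mem_fock_orthogonal (hF a b)
      (Submodule.sub_starProjection_mem_orthogonal _)
  rw [ContinuousLinearMap.comp_apply, h1]
  refine (norm_diagOperator_apply_le (fun v => le_rfl) _).trans
    ((ContinuousLinearMap.le_opNorm _ _).trans ?_)
  gcongr
  exact norm_diagOperator_apply_le X.fock.norm_orthogonalProjectionOnto_apply_le x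

theorem norm_matrixOperator_compression_le
    (F : Matrix (Fin n) (Fin n) (FockSpace Λ →L[ℂ] FockSpace Λ)) :
    ‖matrixOperator (F.map X.compression)‖ ≤ ‖matrixOperator F‖ := by
  refine ContinuousLinearMap.opNorm_le_bound _ (norm_nonneg _) fun x => ?_
  have h1 : matrixOperator (F.map X.compression) x =
      diagOperator n X.fock.orthogonalProjectionOnto (matrixOperator F
        (diagOperator n X.fock.subtypeL x)) := by
    ext1 a
    rw [diagOperator_apply, matrixOperator_apply, matrixOperator_apply, map_sum]
    rfl
  rw [h1]
  refine (norm_diagOperator_apply_le X.fock.norm_orthogonalProjectionOnto_apply_le _).trans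
    ((ContinuousLinearMap.le_opNorm _ _).trans ?_)
  gcongr
  exact norm_diagOperator_apply_le (fun v => le_rfl) x

theorem polynomial_word_nil_apply {D : ℕ} (u : ∀ k, tensorPower Λ k) {w : List Λ}
    (hw : w.length < D) :
    polynomial D u (word []) w = (u w.length : FockSpace Λ) w := by
  classical
  rw [polynomial_apply, Finset.sum_eq_single w.length]
  · rw [List.take_length, List.drop_length, word_apply, if_pos rfl, mul_one]
  · intro k _ hk
    rcases lt_or_gt_of_ne hk with h | h
    · rw [word_apply, if_neg (by simp; omega), mul_zero]
    · rw [(u k).2 _ (by simp; omega), zero_mul]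
  · intro h
    exact absurd (Finset.mem_range.2 hw) h

/-- In degrees up to N the projection is invisible, so B commutes there with the right shifts.
Peeling off last letters reduces B on any word to B on the empty word, which supplies the
coefficients of the polynomials. -/
theorem intertwining_apply_eq {N : ℕ}
    {B : (PiLp 2 fun _ : Fin n => FockSpace Λ) →L[ℂ] PiLp 2 fun _ : Fin n => FockSpace Λ}
    (hB : IsIntertwining (fun i => diagIsometry n (rightShift i)) (X.truncation n N) B)
    (x : PiLp 2 fun _ : Fin n => FockSpace Λ) (a : Fin n) {w : List Λ} (hw : w.length ≤ N) :
    B x a w = matrixOperator (Matrix.of fun a b => polynomial (N + 1)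
      fun k => component k (B (PiLp.single 2 b (word [])) a)) x a w := by
  set T := matrixOperator (Matrix.of fun a b => polynomial (N + 1)
      fun k => component k (B (PiLp.single 2 b (word [])) a)) with hT
  have hTV : ∀ i x, T (diagIsometry n (rightShift i) x) = diagIsometry n (rightShift i) (T x) :=
    fun i x => matrixOperator_diagIsometry (fun a b v => polynomial_rightShift _ _ _ _) x
  have hsingle : ∀ i b (v : List Λ), (PiLp.single 2 b (word (v ++ [i])) :
      PiLp 2 fun _ : Fin n => FockSpace Λ) =
        diagIsometry n (rightShift i) (PiLp.single 2 b (word v)) := by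
    intro i b v
    ext1 c
    by_cases hb : c = b
    · subst hb; simp [rightShift_word]
    · simp [hb]
  have key : ∀ (b : Fin n) (v w : List Λ), w.length ≤ N →
      B (PiLp.single 2 b (word v)) a w = T (PiLp.single 2 b (word v)) a w := by
    intro b v
    induction v using List.reverseRecOn with
    | nil =>
      intro w hw
      rw [hT, matrixOperator_apply, Finset.sum_eq_single b]
      · rw [Matrix.of_apply, PiLp.single_eq_same, polynomial_word_nil_apply _ (by omega),
          component_apply_length]
      · intro c _ hc
        rw [PiLp.single_eq_of_ne 2 hc, map_zero]
      · simp
    | append_singleton v i ih =>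
      intro w hw
      rw [hsingle, hB.apply_shift, starProjection_truncation_apply X _ a hw, hTV,
        diagIsometry_apply, diagIsometry_apply]
      induction w using List.reverseRecOn with
      | nil => simp
      | append_singleton w j _ =>
        by_cases hij : i = j
        · subst hij
          rw [rightShift_append_self, rightShift_append_self, ih w (by simp at hw; omega)]
        · rw [rightShift_append_ne hij, rightShift_append_ne hij]
  have hext : coeff w ∘L PiLp.proj 2 (fun _ : Fin n => FockSpace Λ) a ∘L B =
      coeff w ∘L PiLp.proj 2 (fun _ : Fin n => FockSpace Λ) a ∘L T :=
    PiLp_fock_ext_continuousLinearMap fun b v => key b v w hw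
  exact DFunLike.congr_fun hext x

/-- Commutant lifting for a matrix of polynomials, up to Cesàro means. -/
theorem exists_cesaro_lift {D : ℕ} {u : Fin n → Fin n → ∀ k, tensorPower Λ k}
    (hu : ∀ a b k, D ≤ k → u a b k = 0) {c : ℝ}
    (hc : ‖matrixOperator ((Matrix.of fun a b => polynomial D (u a b)).map X.compression)‖ < c)
    {N : ℕ} (hN : D ≤ N + 1) :
    ∃ t : Fin n → Fin n → ∀ k, tensorPower Λ k,
      (∀ a b, ∀ k ≤ N, t a b k - u a b k ∈ (X.fiber k)ᗮ) ∧
      ‖matrixOperator (Matrix.of fun a b =>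
        polynomial (N + 1) fun k => (1 - (k : ℂ) / (N + 1)) • t a b k)‖ ≤ c := by
  set F : Matrix (Fin n) (Fin n) (FockSpace Λ →L[ℂ] FockSpace Λ) :=
    Matrix.of fun a b => polynomial D (u a b) with hF
  have hc0 : 0 ≤ c := (norm_nonneg (matrixOperator (F.map X.compression))).trans hc.le
  obtain ⟨B, hB, hBc, hBF⟩ := exists_isIntertwining (orthogonalFamily_rightShift Λ n)
    (X.truncation_le n) (fun i _ hy => X.adjoint_rightShift_mem_truncation (by omega) i hy)
    (fun N i _ hy => X.adjoint_rightShift_mem_truncation le_rfl i hy)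
    (F := matrixOperator F)
    (fun i x => matrixOperator_diagIsometry (fun a b v => polynomial_rightShift _ _ _ _) x)
    ((X.norm_starProjection_comp_matrixOperator_le fun a b =>
      polynomial_mem_discAlgebra _ _).trans_lt hc) N
  refine ⟨fun a b k => component k (B (PiLp.single 2 b (word [])) a), fun a b k hk => ?_,
    norm_cesaro_le hc0 fun x => ?_⟩
  · have h1 := congrArg (fun z => z a) (hBF (PiLp.single 2 b (word [])))
    simp only [starProjection_truncation_zero_apply] at h1
    rw [← sub_eq_zero, ← map_sub, Submodule.starProjection_apply_eq_zero_iff,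
      mem_fock_orthogonal_iff] at h1
    have h2 := h1 k
    rw [map_sub] at h2
    -- Applying the polynomial matrix to the empty word in slot b recovers its coefficients u a b k.
    convert h2 using 2
    rw [matrixOperator_apply, Finset.sum_eq_single b]
    · rw [hF, Matrix.of_apply, PiLp.single_eq_same, polynomial_eq_of_le hN (hu a b)]
      ext w
      rw [component_apply]
      split_ifs with hw
      · subst hw
        rw [polynomial_word_nil_apply _ (by omega)]
      · exact (u a b k).2 w hw
    · intro d _ hd
      rw [PiLp.single_eq_of_ne 2 hd, map_zero]
    · simp
  · have h1 : degProj n (Set.Iic N) (matrixOperator (Matrix.of fun a b => polynomial (N + 1)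
        fun k => component k (B (PiLp.single 2 b (word [])) a)) x) =
        degProj n (Set.Iic N) (B x) := by
      refine PiLp_fock_ext fun a w => ?_
      rw [degProj_apply, degProj_apply]
      split_ifs with hw
      · exact (X.intertwining_apply_eq hB x a hw).symm
      · rfl
    rw [h1]
    exact (norm_degProj_le _ _).trans (ContinuousLinearMap.le_of_opNorm_le _ hBc.le x)

end SubproductSystem

/-- Preimages with norm control turn a convergent series of images into a convergent series in the
complete algebra A. -/
theorem isClosed_image_of_exists_norm_le {E K : Type*} [NormedAddCommGroup E]
    [InnerProductSpace ℂ E] [CompleteSpace E] [NormedAddCommGroup K] [InnerProductSpace ℂ K]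
    {f : (E →L[ℂ] E) → K →L[ℂ] K} (hadd : ∀ S T, f (S + T) = f S + f T)
    (hf : ∀ T, ‖f T‖ ≤ ‖T‖) {A : Subalgebra ℂ (E →L[ℂ] E)} (hA : IsClosed (A : Set (E →L[ℂ] E)))
    (h : ∀ S ∈ A, ∀ ε > 0, ∃ T ∈ A, f T = f S ∧ ‖T‖ ≤ ‖f S‖ + ε) : IsClosed (f '' A) := by
  have : CompleteSpace A := hA.completeSpace_coe
  let g : A →+ K →L[ℂ] K := AddMonoidHom.mk' (fun T => f T) fun S T => hadd S T
  have hg : ∀ T, ‖g T‖ ≤ 1 * ‖T‖ := fun T => (hf T).trans_eq (one_mul _).symm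
  have hsurj : (g.mkNormedAddGroupHom 1 hg).SurjectiveOnWith
      (g.mkNormedAddGroupHom 1 hg).range 2 := by
    rintro _ ⟨S, rfl⟩
    change ∃ T : A, f T = f S ∧ ‖T‖ ≤ 2 * ‖f S‖
    by_cases h0 : f S = 0
    · exact ⟨0, (g.map_zero : f 0 = 0).trans h0.symm, by simp⟩
    -- With ε = ‖f S‖ the lift has norm at most 2‖f S‖, the constant required above.
    · obtain ⟨T, hT, hTS, hTn⟩ := h S S.2 ‖f S‖ (norm_pos_iff.2 h0)
      exact ⟨⟨T, hT⟩, hTS, hTn.trans_eq (two_mul _).symm⟩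
  have himage : f '' A = Set.range g := by
    ext T
    exact ⟨fun ⟨S, hS, hST⟩ => ⟨⟨S, hS⟩, hST⟩, fun ⟨S, hST⟩ => ⟨S, S.2, hST⟩⟩
  rw [himage]
  refine isClosed_of_closure_subset fun T hT => ?_
  obtain ⟨S, hS, -⟩ := controlled_closure_of_complete two_pos one_pos hsurj T hT
  exact ⟨S, hS⟩

theorem norm_apply_le_norm_matrixOperator {E : Type*} [NormedAddCommGroup E]
    [InnerProductSpace ℂ E] {n : ℕ} (T : Matrix (Fin n) (Fin n) (E →L[ℂ] E)) (a b : Fin n) :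
    ‖T a b‖ ≤ ‖matrixOperator T‖ := by
  refine ContinuousLinearMap.opNorm_le_bound _ (norm_nonneg (matrixOperator T)) fun v => ?_
  have h1 : T a b v = matrixOperator T (PiLp.single 2 b v) a := by
    rw [matrixOperator_apply, Finset.sum_eq_single b]
    · rw [PiLp.single_eq_same]
    · intro c _ hc
      rw [PiLp.single_eq_of_ne 2 hc, map_zero]
    · simp
  rw [h1]
  refine (PiLp.norm_apply_le _ _).trans (((matrixOperator T).le_opNorm _).trans_eq ?_)
  rw [PiLp.norm_single]

/-! ### Lifts modulo J_X with norm control -/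

namespace SubproductSystem

variable {Λ : Type*} (X : SubproductSystem Λ) {n : ℕ}

/-- The Cesàro mean changes the class modulo J_X by damping u_k; adding (k/(N+1)) u_k restores it,
at a cost in norm of order 1/N since u does not depend on N. -/
theorem exists_lift_polynomial {D : ℕ} {u : Fin n → Fin n → ∀ k, tensorPower Λ k}
    (hu : ∀ a b k, D ≤ k → u a b k = 0) {ε : ℝ} (hε : 0 < ε) :
    ∃ T : Matrix (Fin n) (Fin n) (FockSpace Λ →L[ℂ] FockSpace Λ),
      (∀ a b, T a b ∈ discAlgebra Λ) ∧
      (∀ a b, T a b - polynomial D (u a b) ∈ X.idealClosure) ∧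
      ‖matrixOperator T‖ ≤
        ‖matrixOperator ((Matrix.of fun a b => polynomial D (u a b)).map X.compression)‖ + ε := by
  set c := ‖matrixOperator ((Matrix.of fun a b => polynomial D (u a b)).map X.compression)‖
  set C := ∑ a, ∑ b, ‖polynomial D (fun k => (k : ℂ) • u a b k)‖ with hC
  obtain ⟨N₀, hN₀⟩ := exists_nat_gt (2 * C / ε)
  set N := max N₀ D with hN
  have hN1 : C / ((N : ℝ) + 1) ≤ ε / 2 := by
    rw [div_le_iff₀ (by positivity)]
    rw [div_lt_iff₀ hε] at hN₀
    have : (N₀ : ℝ) ≤ N := by exact_mod_cast le_max_left _ _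
    nlinarith
  have hND : D ≤ N + 1 := (le_max_right N₀ D).trans (Nat.le_succ _)
  have hN0 : (N : ℂ) + 1 ≠ 0 := by exact_mod_cast Nat.succ_ne_zero N
  obtain ⟨t, ht, htc⟩ := X.exists_cesaro_lift hu (c := c + ε / 2)
    (lt_add_of_pos_right _ (half_pos hε)) hND
  set S : Matrix (Fin n) (Fin n) (FockSpace Λ →L[ℂ] FockSpace Λ) :=
    Matrix.of fun a b => polynomial (N + 1) fun k => (1 - (k : ℂ) / (N + 1)) • t a b k with hS
  set G : Matrix (Fin n) (Fin n) (FockSpace Λ →L[ℂ] FockSpace Λ) :=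
    Matrix.of fun a b => ((N : ℂ) + 1)⁻¹ • polynomial D (fun k => (k : ℂ) • u a b k) with hG
  have hGn : ‖matrixOperator G‖ ≤ ε / 2 := by
    refine (norm_matrixOperator_le G).trans (le_trans (le_of_eq ?_) hN1)
    rw [hC, Finset.sum_div]
    refine Finset.sum_congr rfl fun a _ => ?_
    rw [Finset.sum_div]
    refine Finset.sum_congr rfl fun b _ => ?_
    have h1 : ‖(N : ℂ) + 1‖ = (N : ℝ) + 1 := by
      rw [← Nat.cast_succ, Complex.norm_natCast, Nat.cast_succ]
    rw [hG, Matrix.of_apply, norm_smul, norm_inv, h1, div_eq_inv_mul]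
  refine ⟨S + G, fun a b => ?_, fun a b => ?_, ?_⟩
  · exact add_mem (polynomial_mem_discAlgebra _ _)
      (Subalgebra.smul_mem _ (polynomial_mem_discAlgebra _ _) _)
  -- With λ = k/(N+1), the degree k difference is (1 - λ) t_k + λ u_k - u_k = (1 - λ)(t_k - u_k),
  -- which is orthogonal to X_k.
  · have h1 : (S + G) a b - polynomial D (u a b) =
        ∑ k ∈ Finset.range (N + 1), (1 - (k : ℂ) / (N + 1)) • creation (t a b k - u a b k) := by
      rw [Matrix.add_apply, hS, hG, Matrix.of_apply, Matrix.of_apply,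
        polynomial_eq_of_le hND (hu a b),
        polynomial_eq_of_le hND (u := fun k => (k : ℂ) • u a b k)
          (fun k hk => by simp only [hu a b k hk, smul_zero]),
        polynomial, polynomial, polynomial, Finset.smul_sum, ← Finset.sum_add_distrib,
        ← Finset.sum_sub_distrib]
      refine Finset.sum_congr rfl fun k _ => ?_
      rw [creation_smul, creation_smul, creation_sub, smul_smul, div_eq_inv_mul]
      module
    rw [h1]
    exact sum_mem fun k hk => Submodule.smul_mem _ _ (X.creation_mem_idealClosure
      (ht a b k (Nat.lt_succ_iff.1 (Finset.mem_range.1 hk))))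
  · rw [matrixOperator_add]
    exact (norm_add_le _ _).trans ((add_le_add htc hGn).trans_eq (by ring))

theorem map_compression_add (S T : Matrix (Fin n) (Fin n) (FockSpace Λ →L[ℂ] FockSpace Λ)) :
    (S + T).map X.compression = S.map X.compression + T.map X.compression := by
  ext1 a b
  exact X.compressionCLM.map_add _ _

theorem exists_lift {F : Matrix (Fin n) (Fin n) (FockSpace Λ →L[ℂ] FockSpace Λ)}
    (hF : ∀ a b, F a b ∈ discAlgebra Λ) {ε : ℝ} (hε : 0 < ε) :
    ∃ T : Matrix (Fin n) (Fin n) (FockSpace Λ →L[ℂ] FockSpace Λ),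
      (∀ a b, T a b ∈ discAlgebra Λ) ∧ (∀ a b, T a b - F a b ∈ X.idealClosure) ∧
      ‖matrixOperator T‖ ≤ ‖matrixOperator (F.map X.compression)‖ + ε := by
  -- The n² entrywise errors add up to at most ε/3; the + 1 covers n = 0.
  set δ : ℝ := ε / 3 / ((n : ℝ) * n + 1) with hδ
  have hδ0 : 0 < δ := by positivity
  have happrox : ∀ a b, ∃ (D : ℕ) (u : ∀ k, tensorPower Λ k), (∀ k, D ≤ k → u k = 0) ∧
      ‖F a b - polynomial D u‖ < δ := by
    intro a b
    obtain ⟨p, hp, hpF⟩ := Metric.mem_closure_iff.1 (mem_closure_adjoin (hF a b)) δ hδ0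
    obtain ⟨D, u, hu, rfl⟩ := exists_eq_polynomial hp
    exact ⟨D, u, hu, by rwa [← dist_eq_norm]⟩
  choose D' u hu hFu using happrox
  set D := Finset.univ.sup fun p : Fin n × Fin n => D' p.1 p.2 with hD
  have hDD : ∀ a b, D' a b ≤ D := fun a b =>
    Finset.le_sup (f := fun p : Fin n × Fin n => D' p.1 p.2) (Finset.mem_univ (a, b))
  set P : Matrix (Fin n) (Fin n) (FockSpace Λ →L[ℂ] FockSpace Λ) :=
    Matrix.of fun a b => polynomial D (u a b) with hP
  have hFP : ∀ a b, ‖F a b - P a b‖ ≤ δ := fun a b => by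
    rw [hP, Matrix.of_apply, ← polynomial_eq_of_le (hDD a b) (hu a b)]
    exact (hFu a b).le
  have hsmall : ∀ G : Matrix (Fin n) (Fin n) (FockSpace Λ →L[ℂ] FockSpace Λ),
      (∀ a b, ‖G a b‖ ≤ δ) → ‖matrixOperator G‖ ≤ ε / 3 := by
    intro G hG
    refine (norm_matrixOperator_le G).trans ?_
    refine (Finset.sum_le_sum fun a _ => Finset.sum_le_sum fun b _ => hG a b).trans ?_
    simp only [Finset.sum_const, Finset.card_univ, Fintype.card_fin, nsmul_eq_mul]
    rw [← mul_assoc, hδ, mul_div_assoc', div_le_iff₀ (by positivity)]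
    nlinarith
  obtain ⟨T, hT, hTP, hTn⟩ := X.exists_lift_polynomial
    (fun a b k hk => hu a b k ((hDD a b).trans hk)) (div_pos hε three_pos)
  have h1 := hsmall (F - P) fun a b => hFP a b
  have h2 := hsmall (P - F) fun a b => by rw [Matrix.sub_apply, norm_sub_rev]; exact hFP a b
  -- Adding back F - P returns to the class of F itself. The three losses of ε/3 come from
  -- compressing P instead of F, from lifting P, and from this correction.
  refine ⟨T + (F - P), fun a b => ?_, fun a b => ?_, ?_⟩
  · exact add_mem (hT a b) (sub_mem (hF a b) (polynomial_mem_discAlgebra _ _))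
  · convert! hTP a b using 1
    simp only [hP, Matrix.add_apply, Matrix.sub_apply, Matrix.of_apply]
    abel
  · have h3 : ‖matrixOperator (P.map X.compression)‖ ≤
        ‖matrixOperator (F.map X.compression)‖ + ε / 3 := by
      have h4 : P = F + (P - F) := by abel
      rw [h4, map_compression_add, matrixOperator_add]
      exact (norm_add_le (matrixOperator (F.map X.compression))
        (matrixOperator ((P - F).map X.compression))).trans (add_le_add_right ((X.norm_matrixOperator_compression_le _).trans h2) _)
    rw [matrixOperator_add]
    refine (norm_add_le _ _).trans ((add_le_add (hTn.trans (add_le_add_left h3 _)) h1).trans_eq ?_)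
    ring

theorem exists_norm_le_compression {f : FockSpace Λ →L[ℂ] FockSpace Λ} (hf : f ∈ discAlgebra Λ)
    {ε : ℝ} (hε : 0 < ε) : ∃ g ∈ discAlgebra Λ, g - f ∈ X.idealClosure ∧
      ‖g‖ ≤ ‖X.compression f‖ + ε := by
  obtain ⟨T, hT, hTf, hTn⟩ := X.exists_lift (n := 1) (F := Matrix.of fun _ _ => f)
    (fun _ _ => hf) hε
  refine ⟨T 0 0, hT 0 0, hTf 0 0, (norm_apply_le_norm_matrixOperator T 0 0).trans (hTn.trans ?_)⟩
  gcongr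
  refine (norm_matrixOperator_le _).trans (le_of_eq ?_)
  simp

/-! ### Kernel, range and quotient norm of the compression -/

theorem compression_eq_of_sub_mem {f g : FockSpace Λ →L[ℂ] FockSpace Λ}
    (h : f - g ∈ X.idealClosure) : X.compression f = X.compression g := by
  rw [← sub_eq_zero, ← X.compression_eq_zero_of_mem h]
  exact (X.compressionCLM.map_sub f g).symm

theorem compression_eq_zero_iff (f : discAlgebra Λ) : X.compression f = 0 ↔ f ∈ X.ideal := by
  refine ⟨fun h => ?_, fun h => X.compression_eq_zero_of_mem h⟩
  change (f : FockSpace Λ →L[ℂ] FockSpace Λ) ∈ X.idealClosure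
  rw [← SetLike.mem_coe, ← X.isClosed_idealClosure.closure_eq, Metric.mem_closure_iff]
  intro ε hε
  -- As f compresses to 0, its class contains g of norm at most ε/2, so f - g is an element of the
  -- closed space J_X within ε of f.
  obtain ⟨g, -, hgf, hgn⟩ := X.exists_norm_le_compression f.2 (half_pos hε)
  refine ⟨f - g, by rw [SetLike.mem_coe, ← neg_sub]; exact neg_mem hgf, ?_⟩
  rw [dist_eq_norm, sub_sub_cancel]
  rw [h, ContinuousLinearMap.opNorm_zero, zero_add] at hgn
  linarith

/-- The compression as a homomorphism of `𝔄_d` to `B(𝓕_X)`. -/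
def compressionAlgHom : discAlgebra Λ →ₐ[ℂ] (X.fock →L[ℂ] X.fock) :=
  AlgHom.ofLinearMap (X.compressionCLM.toLinearMap ∘ₗ (discAlgebra Λ).val.toLinearMap)
    X.compression_one fun f g => X.compression_mul f.2 g

theorem coe_range_compressionAlgHom :
    (X.compressionAlgHom.range : Set (X.fock →L[ℂ] X.fock)) = X.compression '' discAlgebra Λ := by
  ext g
  constructor
  · rintro ⟨f, rfl⟩
    exact ⟨f, f.2, rfl⟩
  · rintro ⟨f, hf, rfl⟩
    exact ⟨⟨f, hf⟩, rfl⟩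

theorem isClosed_range_compressionAlgHom :
    IsClosed (X.compressionAlgHom.range : Set (X.fock →L[ℂ] X.fock)) := by
  rw [coe_range_compressionAlgHom]
  refine isClosed_image_of_exists_norm_le X.compressionCLM.map_add X.norm_compression_le
    (isClosed_discAlgebra Λ) fun f hf ε hε => ?_
  obtain ⟨g, hg, hgf, hgn⟩ := X.exists_norm_le_compression hf hε
  exact ⟨g, hg, X.compression_eq_of_sub_mem hgf, hgn⟩

/-- The range is an algebra containing the shifts; being closed, it contains all of 𝓐_X. -/
theorem range_compressionAlgHom : X.compressionAlgHom.range = X.tensorAlgebra := by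
  refine le_antisymm ?_ (closedAlgebra_le ?_ X.isClosed_range_compressionAlgHom)
  · rintro _ ⟨f, rfl⟩
    exact X.compression_mem_tensorAlgebra f.2
  · rintro _ ⟨x, rfl⟩
    exact ⟨⟨creation (x : tensorPower Λ 1), creation_mem_discAlgebra _⟩, rfl⟩

/-- The isomorphism of `𝔄_d ⧸ J_X` onto `𝓐_X` induced by the compression. -/
def quotientEquiv : (discAlgebra Λ ⧸ X.ideal) ≃ₐ[ℂ] X.tensorAlgebra :=
  AlgEquiv.ofBijective
    (Ideal.Quotient.liftₐ X.ideal
      (X.compressionAlgHom.codRestrict X.tensorAlgebra fun f => X.compression_mem_tensorAlgebra f.2)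
      fun f hf => Subtype.ext ((X.compression_eq_zero_iff f).2 hf))
    (by
      constructor
      · rw [injective_iff_map_eq_zero]
        intro q hq
        obtain ⟨f, rfl⟩ := Ideal.Quotient.mk_surjective q
        exact Ideal.Quotient.eq_zero_iff_mem.2
          ((X.compression_eq_zero_iff f).1 (congrArg Subtype.val hq))
      · rintro ⟨g, hg⟩
        rw [← range_compressionAlgHom] at hg
        obtain ⟨f, rfl⟩ := hg
        exact ⟨Ideal.Quotient.mk X.ideal f, rfl⟩)

theorem quotientEquiv_mk (f : discAlgebra Λ) :
    (X.quotientEquiv (Ideal.Quotient.mk X.ideal f) : X.fock →L[ℂ] X.fock) = X.compression f := rfl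

/-- Every lift dominates the norm of the compression, and `exists_lift` provides lifts that come
within any ε of it. -/
theorem isCompletelyIsometric_quotientEquiv : IsCompletelyIsometric X.quotientEquiv := by
  intro n F
  have hlift : ∀ T : Matrix (Fin n) (Fin n) (discAlgebra Λ), T.map (Ideal.Quotient.mk X.ideal) = F →
      matrixNorm (F.map X.quotientEquiv) = ‖matrixOperator ((T.map fun a =>
        (a : FockSpace Λ →L[ℂ] FockSpace Λ)).map X.compression)‖ := by
    rintro T rfl
    rfl
  obtain ⟨F₀, hF₀⟩ : ∃ T : Matrix (Fin n) (Fin n) (discAlgebra Λ),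
      T.map (Ideal.Quotient.mk X.ideal) = F := by
    choose T hT using fun a b => Ideal.Quotient.mk_surjective (F a b)
    exact ⟨Matrix.of T, Matrix.ext hT⟩
  refine le_antisymm (le_csInf ⟨_, F₀, hF₀, rfl⟩ ?_) (le_of_forall_pos_le_add fun ε hε => ?_)
  · rintro _ ⟨T, hT, rfl⟩
    rw [hlift T hT]
    exact X.norm_matrixOperator_compression_le _
  · obtain ⟨T, hT, hTF, hTn⟩ := X.exists_lift
      (F := F₀.map fun a => (a : FockSpace Λ →L[ℂ] FockSpace Λ)) (fun a b => (F₀ a b).2) hε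
    rw [hlift F₀ hF₀]
    set T' : Matrix (Fin n) (Fin n) (discAlgebra Λ) := Matrix.of fun a b => ⟨T a b, hT a b⟩
    have hT' : T'.map (Ideal.Quotient.mk X.ideal) = F := by
      rw [← hF₀]
      ext1 a b
      exact Ideal.Quotient.eq.2 (hTF a b)
    have hle : quotientMatrixNorm F ≤ matrixNorm T' := by
      refine csInf_le ⟨0, ?_⟩ ⟨T', hT', rfl⟩
      rintro _ ⟨S, -, rfl⟩
      exact norm_nonneg (matrixOperator _)
    exact hle.trans hTn

end SubproductSystem

end

/-- The compression to the `X`-Fock space has kernel `J_X`, and it induces a completely isometric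
isomorphism of `𝔄_d ⧸ J_X` onto `𝓐_X`, which is the range of the compression. -/
theorem mainTheorem7 {Λ : Type*} (X : SubproductSystem Λ) :
    (∀ f : discAlgebra Λ, X.compression f = 0 ↔ f ∈ X.ideal) ∧
    (X.tensorAlgebra : Set (X.fock →L[ℂ] X.fock)) = X.compression '' (discAlgebra Λ) ∧
    ∃ φ : (discAlgebra Λ ⧸ X.ideal) ≃ₐ[ℂ] X.tensorAlgebra,
      (∀ f : discAlgebra Λ,
        (φ (Ideal.Quotient.mk X.ideal f) : X.fock →L[ℂ] X.fock) = X.compression f) ∧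
      IsCompletelyIsometric φ := by
  refine ⟨X.compression_eq_zero_iff, ?_, X.quotientEquiv, X.quotientEquiv_mk,
    X.isCompletelyIsometric_quotientEquiv⟩
  rw [← X.range_compressionAlgHom, X.coe_range_compressionAlgHom]
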